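/- Let $p\ge 1$ and $n\ge 1$ be integers and let $\Lambda=(\mathbb Z/p\mathbb Z)^2$ be the square torus of size $p$. Let $\Theta$ be the space of $p\times p$ real matrices $\theta$ indexed by $\Lambda$ with $\theta[0,0]=0$ and $\theta[i,j]=\theta[-i,-j]$, and let $C(\theta)$ be the $p^2\times p^2$ matrix with entry $\theta[i_2-i_1,j_2-j_1]$ at the pair of nodes $((i_1,j_1),(i_2,j_2))$. Denote by $\varphi_{\min}$, $\varphi_{\max}$ the smallest and largest eigenvalues of a symmetric matrix. For $0\le i,j<p$ put $|(i,j)|_t^2=[i\wedge(p-i)]^2+[j\wedge(p-j)]^2$. Let $\mathcal M_1$ consist of the empty set and of the sets $\{x\in\Lambda\setminus\{(0,0)\}: |x|_t\le r\}$, $r>1$; its elements are called models. For a model $m$ let $\Theta_m$ be the space of the $\theta\in\Theta$ with support included in $m$, let $d_m=\dim\Theta_m$, and for $\rho>2$ let $$\Theta^+_{m,\rho}=\{\theta\in\Theta_m:\ I_{p^2}-C(\theta)\text{ is positive definite and }\varphi_{\max}(I_{p^2}-C(\theta))<\rho\}.$$ For $\sigma>0$ let ${\bf X}_1,\dots,{\bf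 X}_n$ be independent centered Gaussian fields on $\Lambda$ with covariance matrix $\sigma^2(I_{p^2}-C(\theta))^{-1}$, and let $\mathbb P$ be their joint law. Let $$\gamma_{n,p,p}(\theta')=\frac1{np^2}\sum_{k=1}^n\sum_{j\in\Lambda}\Big({\bf X}_k[j]-\sum_{l\in\Lambda\setminus\{(0,0)\}}\theta'[l]\,{\bf X}_k[j+l]\Big)^2,$$ let $\widehat\theta_{m,\rho}$ be a minimizer of $\gamma_{n,p,p}$ over the closure of $\Theta^+_{m,\rho}$, and, for a penalty $\mathrm{pen}:\mathcal M_1\to\mathbb R^+$, let $\widehat m_\rho$ be a minimizer of $\gamma_{n,p,p}(\widehat\theta_{m,\rho})+\mathrm{pen}(m)$ over $m\in\mathcal M_1$. **Proposition.** There exist numerical constants $p_0$ and $K_1>0$, and a positive function $L=L(\eta,\rho,a,b)$, such that the following holds for all $\rho>2$, $0<\eta<1$, $p>p_0$, $n\ge1$ and $\sigma>0$. Let $m'$ be the largest model in $\mathcal M_1$ that satisfies $d_{m'}\le\sqrt{np^2}$, and let $\theta\in\Theta^+_{m',\rho}$. Assume that for every model $m\in\mathcal M_1$ $$\mathrm{pen}(m')-\mathrm{pen}(m)\le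 K_1(1-\eta)\sigma^2\Big\{\varphi_{\min}\big(I_{p^2}-C(\theta)\big)\wedge\big[\rho-\varphi_{\max}\big(I_{p^2}-C(\theta)\big)\big]\Big\}\frac{d_{m'}-d_m}{np^2}.$$ Then $$\mathbb P\Big\{d_{\widehat m_\rho}>L\,\big[\sqrt{np^2}\wedge p^2\big]\Big\}\ge\frac12,$$ where $L=L\big(\eta,\rho,\varphi_{\min}(I_{p^2}-C(\theta)),\varphi_{\max}(I_{p^2}-C(\theta))\big)$. -/

import Mathlib

namespace GMRF

/-- The nodes of the square toroidal lattice of size `p`: coordinates are taken modulo `p`. -/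
abbrev Torus (p : ℕ) : Type := ZMod p × ZMod p

/-- A `p × p` real matrix indexed by the torus, as a parameter `θ`. -/
abbrev Param (p : ℕ) : Type := Torus p → ℝ

/-- The vector space `Θ`: `θ[0,0] = 0` and `θ[i,j] = θ[-i,-j]` for every node. -/
def Theta (p : ℕ) : Submodule ℝ (Param p) where
  carrier := {θ | θ 0 = 0 ∧ ∀ x, θ (-x) = θ x}
  zero_mem' := by simp
  add_mem' := by
    rintro a b ⟨ha, ha'⟩ ⟨hb, hb'⟩
    exact ⟨by simp [ha, hb], fun x => by simp [ha', hb']⟩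
  smul_mem' := by
    rintro c a ⟨ha, ha'⟩
    exact ⟨by simp [ha], fun x => by simp [ha']⟩

/-- The subspace `Θ_m` of the elements of `Θ` whose support is included in `m`. -/
def ThetaM {p : ℕ} (m : Finset (Torus p)) : Submodule ℝ (Param p) where
  carrier := {θ | θ ∈ Theta p ∧ ∀ x, x ∉ m → θ x = 0}
  zero_mem' := ⟨(Theta p).zero_mem, by simp⟩
  add_mem' := by
    rintro a b ⟨ha, ha'⟩ ⟨hb, hb'⟩
    exact ⟨(Theta p).add_mem ha hb, fun x hx => by simp [ha' x hx, hb' x hx]⟩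
  smul_mem' := by
    rintro c a ⟨ha, ha'⟩
    exact ⟨(Theta p).smul_mem c ha, fun x hx => by simp [ha' x hx]⟩

/-- The dimension `d_m` of the vector space `Θ_m`. -/
noncomputable def dim {p : ℕ} (m : Finset (Torus p)) : ℕ :=
  Module.finrank ℝ (ThetaM m)

/-- The toroidal norm: `|(i,j)|_t ^ 2 = (i ∧ (p - i)) ^ 2 + (j ∧ (p - j)) ^ 2`, where the
coordinates are represented by `0, …, p - 1`. -/
noncomputable def torusNorm {p : ℕ} (x : Torus p) : ℝ :=
  √((min (x.1.val : ℝ) ((p : ℝ) - (x.1.val : ℝ))) ^ 2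
    + (min (x.2.val : ℝ) ((p : ℝ) - (x.2.val : ℝ))) ^ 2)

/-- The collection `M₁` of neighborhoods: the empty neighborhood, and the traces on
`Λ \ {(0,0)}` of the discs of radius `r > 1` centered at `(0,0)`. -/
def M1 (p : ℕ) : Set (Finset (Torus p)) :=
  {m | m = ∅ ∨ ∃ r : ℝ, 1 < r ∧ ∀ x : Torus p, x ∈ m ↔ x ≠ 0 ∧ torusNorm x ≤ r}

/-- The block circulant matrix `C(θ)`, with entry `θ[i₂ - i₁, j₂ - j₁]` at the pair of
nodes `(i₁,j₁)`, `(i₂,j₂)`. -/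
def C {p : ℕ} (θ : Param p) : Matrix (Torus p) (Torus p) ℝ :=
  Matrix.of fun x y => θ (y - x)

/-- The largest eigenvalue (used for symmetric matrices only). -/
noncomputable def phiMax {ι : Type*} [Fintype ι] [DecidableEq ι] (A : Matrix ι ι ℝ) : ℝ :=
  sSup (spectrum ℝ A)

/-- The smallest eigenvalue (used for symmetric matrices only). -/
noncomputable def phiMin {ι : Type*} [Fintype ι] [DecidableEq ι] (A : Matrix ι ι ℝ) : ℝ :=
  sInf (spectrum ℝ A)

/-- The set `Θ⁺_{m,ρ}`: the `θ ∈ Θ_m` such that `I - C(θ)` is positive definite with largest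
eigenvalue smaller than `ρ`. -/
def ThetaPlus {p : ℕ} [NeZero p] (ρ : ℝ) (m : Finset (Torus p)) : Set (Param p) :=
  {θ | θ ∈ ThetaM m ∧ (1 - C θ).PosDef ∧ phiMax (1 - C θ) < ρ}

/-- The covariance matrix `Σ = σ² (I - C(θ))⁻¹`. -/
noncomputable def covMat {p : ℕ} [NeZero p] (σ : ℝ) (θ : Param p) :
    Matrix (Torus p) (Torus p) ℝ :=
  σ ^ 2 • (1 - C θ)⁻¹

/-- A sample of `n` observations of the field. -/
abbrev Sample (n p : ℕ) : Type := Fin n → EuclideanSpace ℝ (Torus p)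

/-- The law of `n` independent observations of the centered Gaussian field with covariance
matrix `σ² (I - C(θ))⁻¹`. -/
noncomputable def sampleLaw (n : ℕ) {p : ℕ} [NeZero p] (σ : ℝ) (θ : Param p) :
    MeasureTheory.Measure (Sample n p) :=
  MeasureTheory.Measure.pi fun _ : Fin n =>
    ProbabilityTheory.multivariateGaussian 0 (covMat σ θ)

/-- The conditional least squares criterion `γ_{n,p,p}(θ')` computed on the observations. -/
noncomputable def gammaCLS {n p : ℕ} [NeZero p] (X : Sample n p) (θ' : Param p) : ℝ :=
  (1 / ((n : ℝ) * (p : ℝ) ^ 2)) *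
    ∑ i : Fin n, ∑ j : Torus p,
      (X i j - ∑ l ∈ (Finset.univ : Finset (Torus p)).erase 0, θ' l * X i (j + l)) ^ 2

/-- `θhat m X` is a minimizer of the conditional least squares criterion on the closure of
`Θ⁺_{m,ρ}`, for every model `m` of `M₁` and all observations `X`. -/
def IsCLSEstimator {n p : ℕ} [NeZero p] (ρ : ℝ)
    (θhat : Finset (Torus p) → Sample n p → Param p) : Prop :=
  ∀ m ∈ M1 p, ∀ X : Sample n p,
    θhat m X ∈ closure (ThetaPlus ρ m) ∧
      ∀ θ' ∈ closure (ThetaPlus ρ m), gammaCLS X (θhat m X) ≤ gammaCLS X θ'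

/-- `mhat X` is a model of `M₁` that minimizes `γ_{n,p,p}(θhat m X) + pen m`, for all
observations `X`. -/
def IsSelectedModel {n p : ℕ} [NeZero p] (pen : Finset (Torus p) → ℝ)
    (θhat : Finset (Torus p) → Sample n p → Param p)
    (mhat : Sample n p → Finset (Torus p)) : Prop :=
  ∀ X : Sample n p, mhat X ∈ M1 p ∧
    ∀ m ∈ M1 p,
      gammaCLS X (θhat (mhat X) X) + pen (mhat X) ≤ gammaCLS X (θhat m X) + pen m

/-- `m'` is the largest model of `M₁` with `d_{m'} ≤ √(n p²)`. -/
def IsLargestModel (n : ℕ) {p : ℕ} (m' : Finset (Torus p)) : Prop :=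
  IsGreatest {m | m ∈ M1 p ∧ (dim m : ℝ) ≤ √((n : ℝ) * (p : ℝ) ^ 2)} m'

end GMRF

/-!
# A lower bound on the penalty for the selection of neighborhoods of a stationary Gaussian field

The matrices `C(θ)`, `θ ∈ Θ`, are diagonalized together by the Hartley matrix, whose entries are
`(cos + sin)(2π⟨ω, l⟩ / p) / p`, with eigenvalues `hat θ ω = ∑ θ l cos (2π⟨ω, l⟩ / p)`. In the
Hartley basis the sample becomes a family of `n p²` independent standard Gaussian variables `w`,
and the criterion is `σ² / (n p²)` times
`specCrit θ' = ∑ (1 - hat θ' ω)² / (1 - hat θ ω) * (n + Y ω)`, where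
`Y ω = ∑ₖ (w (k, ω)² - 1)`. With `S l = ∑ cos (2π⟨ω, l⟩ / p) Y ω`, it expands around `θ` as
`specCrit (θ + h) - specCrit θ = -2 ∑ h l S l + ∑ (hat h ω)² / (1 - hat θ ω) * (n + Y ω)`.
Write `N = √(n p²)`, `δ = φ_min ∧ (ρ - φ_max)` and `k` for the number of nodes of `m'`, which is
between `d_{m'}` and `2 d_{m'}`.

* Gain of the large model (`exists_specCrit_le`). The step `h = δ S / (9 N²)` on `m'` has an `ℓ¹`
  norm smaller than `δ` because `d_{m'} ≤ N`, hence `θ + h` is still in `Θ⁺`. Since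
  `∑_{l ∈ m'} S l²` is close to its mean, which is of order `k N²`, the criterion decreases by at
  least `δ k / 18`.
* Loss of the small models (`specCrit_sub_le_of_mem_ThetaM`). The models are nested, so all those
  with `d_m ≤ L (N ∧ p²)` are included in a largest one, `M`. For `θ' ∈ Θ_M` the difference
  `θ' - θ` lies in a space spanned by the nodes of `M` and the single direction of the restriction
  of `θ` to the complement of `M`. On this space the quadratic term is nondegenerate, so the
  criterion is at least `specCrit θ - 32 φ_max (|M| + 1)`, and the loss is at most `δ k / 36` when
  `L` is small. If `M` is empty then no choice of `L` makes `|M| + 1` small: either the `ℓ¹` norm of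
  `θ` is at most `1 / 2`, so that `δ ≥ 1 / 2` and `φ_max ≤ 3 / 2`, or the bias, which is at least
  of order `N² ‖θ‖² / φ_max` with `φ_max ≤ 3 ‖θ‖₁ ≤ 3 √k ‖θ‖`, dominates the fluctuations.

All the random quantities are controlled by second moments: those of linear statistics
`∑ f ω Y ω`, and the variance of `∑_{l ∈ m'} S l²`, a quadratic form in independent centered
variables (`integral_quadForm_sub_sq`). One application of Markov's inequality
(`half_le_measure_good`) then gives the probability `1 / 2`. The comparison of `k` with `N ∧ p²`
(`min_le_mul_card_of_greatest`) is a count of lattice points in discs.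
-/

open MeasureTheory ProbabilityTheory Finset

namespace GMRF

/-! ### Moments of the standard Gaussian distribution -/

/-- The polynomials `P k` such that the `k`-th derivative of `exp (t ^ 2 / 2)` is
`P k t * exp (t ^ 2 / 2)`. -/
noncomputable def expHalfSqPoly : ℕ → Polynomial ℝ
  | 0 => 1
  | k + 1 => (expHalfSqPoly k).derivative + Polynomial.X * expHalfSqPoly k

lemma derivative_expHalfSqPoly (k : ℕ) :
    (expHalfSqPoly (k + 1)).derivative = ((k : Polynomial ℝ) + 1) * expHalfSqPoly k := by
  induction k with
  | zero => simp [expHalfSqPoly]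
  | succ k ih =>
    rw [expHalfSqPoly, ih]
    simp only [Polynomial.derivative_add, Polynomial.derivative_mul, ih,
      Polynomial.derivative_natCast, Polynomial.derivative_one, Polynomial.derivative_X]
    rw [expHalfSqPoly]
    push_cast
    ring

lemma iteratedDeriv_exp_half_sq (k : ℕ) :
    iteratedDeriv k (fun t : ℝ => Real.exp (t ^ 2 / 2)) = fun t =>
      (expHalfSqPoly k).eval t * Real.exp (t ^ 2 / 2) := by
  induction k with
  | zero => ext t; simp [expHalfSqPoly]
  | succ k ih =>
    rw [iteratedDeriv_succ, ih]
    ext t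
    have h1 : HasDerivAt (fun t : ℝ => Real.exp (t ^ 2 / 2)) (Real.exp (t ^ 2 / 2) * t) t := by
      have := (((hasDerivAt_id t).pow 2).div_const 2).exp
      simpa using this
    refine (((expHalfSqPoly k).hasDerivAt t).mul h1).deriv.trans ?_
    simp [expHalfSqPoly]
    ring

lemma integrable_pow_gaussianReal (k : ℕ) :
    Integrable (fun x : ℝ => x ^ k) (gaussianReal 0 1) := by
  have h := (memLp_id_gaussianReal (μ := 0) (v := 1) (k : NNReal)).integrable_norm_pow'
  refine (h.mono' (by fun_prop) (ae_of_all _ fun x => ?_))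
  simp

lemma integral_pow_gaussianReal (k : ℕ) :
    ∫ x, x ^ k ∂(gaussianReal 0 1) = (expHalfSqPoly k).eval 0 := by
  have h := iteratedDeriv_mgf_zero (X := fun x : ℝ => x) (μ := gaussianReal 0 1) (by simp) k
  rw [mgf_fun_id_gaussianReal] at h
  simp only [Pi.pow_apply] at h
  rw [← h]
  have := congrFun (iteratedDeriv_exp_half_sq k) 0
  simpa using this

lemma integral_pow_add_two_gaussianReal (k : ℕ) :
    ∫ x, x ^ (k + 2) ∂(gaussianReal 0 1) = (k + 1) * ∫ x, x ^ k ∂(gaussianReal 0 1) := by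
  rw [integral_pow_gaussianReal, integral_pow_gaussianReal, expHalfSqPoly,
    derivative_expHalfSqPoly]
  simp

lemma integral_sq_gaussianReal : ∫ x, x ^ 2 ∂(gaussianReal 0 1) = 1 := by
  simpa using integral_pow_add_two_gaussianReal 0

lemma integral_pow_four_gaussianReal : ∫ x, x ^ 4 ∂(gaussianReal 0 1) = 3 := by
  rw [integral_pow_add_two_gaussianReal 2, integral_sq_gaussianReal]; norm_num

lemma integral_pow_six_gaussianReal : ∫ x, x ^ 6 ∂(gaussianReal 0 1) = 15 := by
  rw [integral_pow_add_two_gaussianReal 4, integral_pow_four_gaussianReal]; norm_num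

lemma integral_pow_eight_gaussianReal : ∫ x, x ^ 8 ∂(gaussianReal 0 1) = 105 := by
  rw [integral_pow_add_two_gaussianReal 6, integral_pow_six_gaussianReal]; norm_num

lemma integrable_sq_sub_one_pow_gaussianReal (k : ℕ) :
    Integrable (fun x : ℝ => (x ^ 2 - 1) ^ k) (gaussianReal 0 1) := by
  have h : (fun x : ℝ => (x ^ 2 - 1) ^ k)
      = fun x => ∑ m ∈ range (k + 1), x ^ (2 * m) * (-1 : ℝ) ^ (k - m) * (k.choose m : ℝ) := by
    ext x
    rw [sub_eq_add_neg, add_pow]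
    simp [pow_mul]
  rw [h]
  exact integrable_finsetSum _ fun m _ =>
    ((integrable_pow_gaussianReal (2 * m)).mul_const _).mul_const _

lemma integral_sq_sub_one_gaussianReal :
    ∫ x, (x ^ 2 - 1) ∂(gaussianReal 0 1) = 0 := by
  rw [integral_sub (integrable_pow_gaussianReal 2) (integrable_const _),
    integral_sq_gaussianReal]
  simp

lemma integral_sq_sub_one_sq_gaussianReal :
    ∫ x, (x ^ 2 - 1) ^ 2 ∂(gaussianReal 0 1) = 2 := by
  have h : (fun x : ℝ => (x ^ 2 - 1) ^ 2) = fun x => x ^ 4 - 2 * x ^ 2 + 1 := by ext; ring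
  have i2 := (integrable_pow_gaussianReal 2).const_mul 2
  have i42 : Integrable (fun x : ℝ => x ^ 4 - 2 * x ^ 2) (gaussianReal 0 1) :=
    (integrable_pow_gaussianReal 4).sub i2
  rw [h, integral_add i42 (integrable_const _),
    integral_sub (integrable_pow_gaussianReal 4) i2, integral_const_mul,
    integral_sq_gaussianReal, integral_pow_four_gaussianReal]
  simp
  norm_num

lemma integral_sq_sub_one_pow_four_gaussianReal :
    ∫ x, (x ^ 2 - 1) ^ 4 ∂(gaussianReal 0 1) = 60 := by
  have h : (fun x : ℝ => (x ^ 2 - 1) ^ 4)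
      = fun x => x ^ 8 - 4 * x ^ 6 + (6 * x ^ 4 - 4 * x ^ 2) + 1 := by ext; ring
  have i8 := integrable_pow_gaussianReal 8
  have i6 := (integrable_pow_gaussianReal 6).const_mul 4
  have i4 := (integrable_pow_gaussianReal 4).const_mul 6
  have i2 := (integrable_pow_gaussianReal 2).const_mul 4
  have i86 : Integrable (fun x : ℝ => x ^ 8 - 4 * x ^ 6) (gaussianReal 0 1) := i8.sub i6
  have i42 : Integrable (fun x : ℝ => 6 * x ^ 4 - 4 * x ^ 2) (gaussianReal 0 1) := i4.sub i2
  have i8642 : Integrable (fun x : ℝ => x ^ 8 - 4 * x ^ 6 + (6 * x ^ 4 - 4 * x ^ 2))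
      (gaussianReal 0 1) := i86.add i42
  rw [h, integral_add i8642 (integrable_const _), integral_add i86 i42, integral_sub i8 i6,
    integral_sub i4 i2,
    integral_const_mul, integral_const_mul, integral_const_mul]
  rw [integral_sq_gaussianReal, integral_pow_four_gaussianReal, integral_pow_six_gaussianReal,
    integral_pow_eight_gaussianReal]
  simp
  norm_num

/-! ### Second moments of linear and quadratic forms in independent variables -/

section Forms

variable {ι E : Type*} [Fintype ι] {u : E → ℝ}

lemma linForm_sq (x : ι → E) (g : ι → ℝ) :
    (∑ i, g i * u (x i)) ^ 2 = ∑ a, ∑ b, g a * g b * (u (x a) * u (x b)) := by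
  rw [sq, sum_mul_sum]
  exact sum_congr rfl fun a _ => sum_congr rfl fun b _ => by ring

lemma quadForm_sq (x : ι → E) (G : ι → ι → ℝ) :
    (∑ a, ∑ b, G a b * (u (x a) * u (x b))) ^ 2
      = ∑ a, ∑ b, ∑ c, ∑ d, G a b * G c d * (u (x a) * u (x b) * (u (x c) * u (x d))) := by
  rw [sq, sum_mul]
  refine sum_congr rfl fun a _ => ?_
  rw [sum_mul]
  refine sum_congr rfl fun b _ => ?_
  rw [mul_sum]
  refine sum_congr rfl fun c _ => ?_
  rw [mul_sum]
  exact sum_congr rfl fun d _ => by ring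

lemma prod_pow_two [DecidableEq ι] (x : ι → E) (a b : ι) :
    ∏ i, u (x i) ^ ((if i = a then 1 else 0) + (if i = b then 1 else 0)) = u (x a) * u (x b) := by
  simp only [pow_add, prod_mul_distrib, pow_ite, pow_one, pow_zero, prod_ite_eq', mem_univ,
    if_true]

lemma prod_pow_four [DecidableEq ι] (x : ι → E) (a b c d : ι) :
    ∏ i, u (x i) ^ ((if i = a then 1 else 0) + (if i = b then 1 else 0)
      + ((if i = c then 1 else 0) + (if i = d then 1 else 0)))
      = u (x a) * u (x b) * (u (x c) * u (x d)) := by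
  simp only [pow_add, prod_mul_distrib, pow_ite, pow_one, pow_zero, prod_ite_eq', mem_univ,
    if_true]

variable [MeasurableSpace E] {ν : Measure E} [IsProbabilityMeasure ν]

lemma integrable_prod_pow (hu : ∀ k : ℕ, Integrable (fun x => u x ^ k) ν) (e : ι → ℕ) :
    Integrable (fun x : ι → E => ∏ i, u (x i) ^ e i) (Measure.pi fun _ => ν) :=
  Integrable.fintype_prod (f := fun i x => u x ^ e i) fun i => hu (e i)

variable [DecidableEq ι]

lemma integrable_mul_two (hu : ∀ k : ℕ, Integrable (fun x => u x ^ k) ν) (a b : ι) :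
    Integrable (fun x : ι → E => u (x a) * u (x b)) (Measure.pi fun _ => ν) := by
  have := integrable_prod_pow hu
    (fun i : ι => (if i = a then 1 else 0) + (if i = b then 1 else 0))
  simpa only [prod_pow_two] using this

lemma integrable_mul_four (hu : ∀ k : ℕ, Integrable (fun x => u x ^ k) ν) (a b c d : ι) :
    Integrable (fun x : ι → E => u (x a) * u (x b) * (u (x c) * u (x d)))
      (Measure.pi fun _ => ν) := by
  have := integrable_prod_pow hu
    (fun i : ι => (if i = a then 1 else 0) + (if i = b then 1 else 0)
      + ((if i = c then 1 else 0) + (if i = d then 1 else 0)))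
  simpa only [prod_pow_four] using this

lemma integral_mul_two (h1 : ∫ x, u x ∂ν = 0) (a b : ι) :
    ∫ x : ι → E, u (x a) * u (x b) ∂(Measure.pi fun _ => ν)
      = if a = b then ∫ x, u x ^ 2 ∂ν else 0 := by
  have h := integral_fintype_prod_eq_prod (μ := fun _ : ι => ν)
    (f := fun i x => u x ^ ((if i = a then 1 else 0) + (if i = b then 1 else 0)))
  simp only [prod_pow_two] at h
  rw [h]
  split_ifs with hab
  · subst hab
    rw [Finset.prod_eq_single a]
    · simp
    · intro i _ hi; simp [hi]
    · simp
  · refine Finset.prod_eq_zero (mem_univ a) ?_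
    simp [hab, h1]

/-- The mixed fourth moments of independent copies of a centered variable, the analogue of the
Wick formula: the pairings contribute the squared variance, and the fully diagonal terms a
correction. -/
lemma integral_mul_four (h1 : ∫ x, u x ∂ν = 0) {s κ : ℝ} (h2 : ∫ x, u x ^ 2 ∂ν = s)
    (h4 : ∫ x, u x ^ 4 ∂ν = κ) (a b c d : ι) :
    ∫ x : ι → E, u (x a) * u (x b) * (u (x c) * u (x d)) ∂(Measure.pi fun _ => ν)
      = s ^ 2 * ((if a = b then 1 else 0) * (if c = d then 1 else 0))
        + s ^ 2 * ((if a = c then 1 else 0) * (if b = d then 1 else 0))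
        + s ^ 2 * ((if a = d then 1 else 0) * (if b = c then 1 else 0))
        + (κ - 3 * s ^ 2) * ((if a = b then 1 else 0) * (if c = d then 1 else 0)
            * (if a = c then 1 else 0)) := by
  have h := integral_fintype_prod_eq_prod (μ := fun _ : ι => ν)
    (f := fun i x => u x ^ ((if i = a then 1 else 0) + (if i = b then 1 else 0)
      + ((if i = c then 1 else 0) + (if i = d then 1 else 0))))
  simp only [prod_pow_four] at h
  rw [h]
  -- an index that occurs exactly once makes the product vanish
  have single : ∀ i : ι, ((if i = a then 1 else 0) + (if i = b then 1 else 0)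
      + ((if i = c then 1 else 0) + (if i = d then 1 else 0))) = 1 →
      ∏ i : ι, ∫ x, u x ^ ((if i = a then 1 else 0) + (if i = b then 1 else 0)
      + ((if i = c then 1 else 0) + (if i = d then 1 else 0))) ∂ν = 0 := by
    intro i hi
    refine Finset.prod_eq_zero (mem_univ i) ?_
    rw [hi]; simpa using h1
  -- two distinct indices that occur twice each
  have double : ∀ i j : ι, i ≠ j → (∀ k : ι, ((if k = a then 1 else 0) + (if k = b then 1 else 0)
      + ((if k = c then 1 else 0) + (if k = d then 1 else 0)))
        = if k = i then 2 else if k = j then 2 else 0) →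
      ∏ i : ι, ∫ x, u x ^ ((if i = a then 1 else 0) + (if i = b then 1 else 0)
      + ((if i = c then 1 else 0) + (if i = d then 1 else 0))) ∂ν = s ^ 2 := by
    intro i j hij hk
    rw [Finset.prod_eq_mul i j hij]
    · rw [hk, hk]; simp [hij.symm, h2, sq s]
    · intro k _ hk'; rw [hk]; simp [hk'.1, hk'.2]
    · simp
    · simp
  by_cases hab : a = b
  · subst hab
    by_cases hcd : c = d
    · subst hcd
      by_cases hac : a = c
      · subst hac
        rw [Finset.prod_eq_single a]
        · simp [h4]; ring
        · intro i _ hi; simp [hi]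
        · simp
      · rw [double a c hac (by intro k; split_ifs <;> simp_all)]
        simp [hac]
    · by_cases hac : a = c
      · subst hac
        rw [single d (by simp [Ne.symm hcd])]
        simp [hcd]
      · rw [single c (by simp [Ne.symm hac, hcd])]
        simp [hcd, hac]
  · by_cases hac : a = c
    · subst hac
      by_cases hbd : b = d
      · subst hbd
        rw [double a b hab (by intro k; split_ifs <;> simp_all)]
        simp [hab]
      · rw [single b (by simp [Ne.symm hab, hbd])]
        simp [hab, hbd, Ne.symm hab]
    · by_cases had : a = d
      · subst had
        by_cases hbc : b = c
        · subst hbc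
          rw [double a b hab (by intro k; split_ifs <;> simp_all)]
          simp [hab]
        · rw [single b (by simp [Ne.symm hab, hbc])]
          simp [hab, hbc, hac]
      · rw [single a (by simp [hab, hac, had])]
        simp [hab, hac, had]

lemma integrable_linForm_sq (hu : ∀ k : ℕ, Integrable (fun x => u x ^ k) ν) (g : ι → ℝ) :
    Integrable (fun x : ι → E => (∑ i, g i * u (x i)) ^ 2) (Measure.pi fun _ => ν) := by
  simp only [linForm_sq]
  exact integrable_finsetSum _ fun a _ => integrable_finsetSum _ fun b _ =>
    (integrable_mul_two hu a b).const_mul _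

lemma integral_linForm_sq (hu : ∀ k : ℕ, Integrable (fun x => u x ^ k) ν)
    (h1 : ∫ x, u x ∂ν = 0) {s : ℝ} (h2 : ∫ x, u x ^ 2 ∂ν = s) (g : ι → ℝ) :
    ∫ x : ι → E, (∑ i, g i * u (x i)) ^ 2 ∂(Measure.pi fun _ => ν) = s * ∑ i, g i ^ 2 := by
  simp only [linForm_sq]
  rw [integral_finsetSum _ fun a _ => integrable_finsetSum _ fun b _ =>
    (integrable_mul_two hu a b).const_mul _, mul_sum]
  refine sum_congr rfl fun a _ => ?_
  rw [integral_finsetSum _ fun b _ => (integrable_mul_two hu a b).const_mul _]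
  simp only [integral_const_mul, integral_mul_two h1, h2]
  simp
  ring

lemma integrable_quadForm (hu : ∀ k : ℕ, Integrable (fun x => u x ^ k) ν) (G : ι → ι → ℝ) :
    Integrable (fun x : ι → E => ∑ a, ∑ b, G a b * (u (x a) * u (x b)))
      (Measure.pi fun _ => ν) :=
  integrable_finsetSum _ fun a _ => integrable_finsetSum _ fun b _ =>
    (integrable_mul_two hu a b).const_mul _

lemma integral_quadForm (hu : ∀ k : ℕ, Integrable (fun x => u x ^ k) ν)
    (h1 : ∫ x, u x ∂ν = 0) {s : ℝ} (h2 : ∫ x, u x ^ 2 ∂ν = s) (G : ι → ι → ℝ) :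
    ∫ x : ι → E, ∑ a, ∑ b, G a b * (u (x a) * u (x b)) ∂(Measure.pi fun _ => ν)
      = s * ∑ a, G a a := by
  rw [integral_finsetSum _ fun a _ => integrable_finsetSum _ fun b _ =>
    (integrable_mul_two hu a b).const_mul _, mul_sum]
  refine sum_congr rfl fun a _ => ?_
  rw [integral_finsetSum _ fun b _ => (integrable_mul_two hu a b).const_mul _]
  simp only [integral_const_mul, integral_mul_two h1, h2]
  simp
  ring

lemma integrable_quadForm_sq (hu : ∀ k : ℕ, Integrable (fun x => u x ^ k) ν) (G : ι → ι → ℝ) :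
    Integrable (fun x : ι → E => (∑ a, ∑ b, G a b * (u (x a) * u (x b))) ^ 2)
      (Measure.pi fun _ => ν) := by
  simp only [quadForm_sq]
  exact integrable_finsetSum _ fun a _ => integrable_finsetSum _ fun b _ =>
    integrable_finsetSum _ fun c _ => integrable_finsetSum _ fun d _ =>
    (integrable_mul_four hu a b c d).const_mul _

lemma integral_quadForm_sq (hu : ∀ k : ℕ, Integrable (fun x => u x ^ k) ν)
    (h1 : ∫ x, u x ∂ν = 0) {s κ : ℝ} (h2 : ∫ x, u x ^ 2 ∂ν = s) (h4 : ∫ x, u x ^ 4 ∂ν = κ)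
    (G : ι → ι → ℝ) (hG : ∀ a b, G a b = G b a) :
    ∫ x : ι → E, (∑ a, ∑ b, G a b * (u (x a) * u (x b))) ^ 2 ∂(Measure.pi fun _ => ν)
      = s ^ 2 * (∑ a, G a a) ^ 2 + 2 * s ^ 2 * ∑ a, ∑ b, G a b ^ 2
        + (κ - 3 * s ^ 2) * ∑ a, G a a ^ 2 := by
  simp only [quadForm_sq]
  rw [integral_finsetSum _ fun a _ => integrable_finsetSum _ fun b _ =>
    integrable_finsetSum _ fun c _ => integrable_finsetSum _ fun d _ =>
    (integrable_mul_four hu a b c d).const_mul _]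
  have step : ∀ a b : ι, ∫ x : ι → E, ∑ c, ∑ d, G a b * G c d
        * (u (x a) * u (x b) * (u (x c) * u (x d))) ∂(Measure.pi fun _ => ν)
      = s ^ 2 * (if a = b then G a a * ∑ c, G c c else 0) + 2 * s ^ 2 * G a b ^ 2
        + (κ - 3 * s ^ 2) * (if a = b then G a a ^ 2 else 0) := by
    intro a b
    rw [integral_finsetSum _ fun c _ => integrable_finsetSum _ fun d _ =>
      (integrable_mul_four hu a b c d).const_mul _]
    simp_rw [integral_finsetSum _ fun d _ => (integrable_mul_four hu a b _ d).const_mul _,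
      integral_const_mul, integral_mul_four h1 h2 h4, mul_add, sum_add_distrib]
    have e1 : ∑ c, ∑ d, G a b * G c d * (s ^ 2 * ((if a = b then 1 else 0)
        * (if c = d then 1 else 0))) = s ^ 2 * (if a = b then G a a * ∑ c, G c c else 0) := by
      split_ifs with hab
      · subst hab
        simp [mul_sum]
        exact sum_congr rfl fun c _ => by ring
      · simp
    have e2 : ∑ c, ∑ d, G a b * G c d * (s ^ 2 * ((if a = c then 1 else 0)
        * (if b = d then 1 else 0))) = s ^ 2 * G a b ^ 2 := by
      simp; ring
    have e3 : ∑ c, ∑ d, G a b * G c d * (s ^ 2 * ((if a = d then 1 else 0)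
        * (if b = c then 1 else 0))) = s ^ 2 * G a b ^ 2 := by
      simp [hG b a]; ring
    have e4 : ∑ c, ∑ d, G a b * G c d * ((κ - 3 * s ^ 2) * ((if a = b then 1 else 0)
        * (if c = d then 1 else 0) * (if a = c then 1 else 0)))
        = (κ - 3 * s ^ 2) * (if a = b then G a a ^ 2 else 0) := by
      split_ifs with hab
      · subst hab
        simp; ring
      · simp
    rw [e1, e2, e3, e4]
    ring
  have step' : ∀ a : ι, ∫ x : ι → E, ∑ b, ∑ c, ∑ d, G a b * G c d
        * (u (x a) * u (x b) * (u (x c) * u (x d))) ∂(Measure.pi fun _ => ν)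
      = s ^ 2 * (G a a * ∑ c, G c c) + 2 * s ^ 2 * ∑ b, G a b ^ 2
        + (κ - 3 * s ^ 2) * G a a ^ 2 := by
    intro a
    rw [integral_finsetSum _ fun b _ => integrable_finsetSum _ fun c _ =>
      integrable_finsetSum _ fun d _ => (integrable_mul_four hu a b c d).const_mul _]
    simp only [step, sum_add_distrib, ← mul_sum]
    simp
  simp only [step', sum_add_distrib, ← mul_sum, ← sum_mul]
  ring

/-- The variance of a symmetric quadratic form in independent copies of a centered variable. -/
lemma integral_quadForm_sub_sq (hu : ∀ k : ℕ, Integrable (fun x => u x ^ k) ν)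
    (h1 : ∫ x, u x ∂ν = 0) {s κ : ℝ} (h2 : ∫ x, u x ^ 2 ∂ν = s) (h4 : ∫ x, u x ^ 4 ∂ν = κ)
    (G : ι → ι → ℝ) (hG : ∀ a b, G a b = G b a) :
    Integrable (fun x : ι → E => (∑ a, ∑ b, G a b * (u (x a) * u (x b)) - s * ∑ a, G a a) ^ 2)
      (Measure.pi fun _ => ν) ∧
    ∫ x : ι → E, (∑ a, ∑ b, G a b * (u (x a) * u (x b)) - s * ∑ a, G a a) ^ 2
        ∂(Measure.pi fun _ => ν)
      = 2 * s ^ 2 * ∑ a, ∑ b, G a b ^ 2 + (κ - 3 * s ^ 2) * ∑ a, G a a ^ 2 := by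
  have i2 := integrable_quadForm_sq hu G
  have i1 := (integrable_quadForm hu G).mul_const (2 * (s * ∑ a, G a a))
  have e : (fun x : ι → E => (∑ a, ∑ b, G a b * (u (x a) * u (x b)) - s * ∑ a, G a a) ^ 2)
      = fun x => (∑ a, ∑ b, G a b * (u (x a) * u (x b))) ^ 2
        - (∑ a, ∑ b, G a b * (u (x a) * u (x b))) * (2 * (s * ∑ a, G a a))
        + (s * ∑ a, G a a) ^ 2 := by
    ext x; ring
  have i21 : Integrable (fun x : ι → E => (∑ a, ∑ b, G a b * (u (x a) * u (x b))) ^ 2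
      - (∑ a, ∑ b, G a b * (u (x a) * u (x b))) * (2 * (s * ∑ a, G a a)))
      (Measure.pi fun _ => ν) := i2.sub i1
  rw [e]
  refine ⟨i21.add (integrable_const _), ?_⟩
  rw [integral_add i21 (integrable_const _), integral_sub i2 i1, integral_mul_const,
    integral_quadForm hu h1 h2, integral_quadForm_sq hu h1 h2 h4 G hG]
  simp
  ring

end Forms

/-! ### The discs of the torus and the dimensions of the models -/

lemma min_val_neg {p : ℕ} [NeZero p] (a : ZMod p) :
    min ((-a).val : ℝ) ((p : ℝ) - ((-a).val : ℝ)) = min (a.val : ℝ) ((p : ℝ) - (a.val : ℝ)) := by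
  rw [ZMod.neg_val]
  split_ifs with h
  · simp [h]
  · rw [Nat.cast_sub (ZMod.val_lt a).le, sub_sub_cancel, min_comm]

lemma torusNorm_neg {p : ℕ} [NeZero p] (x : Torus p) : torusNorm (-x) = torusNorm x := by
  unfold torusNorm
  rw [Prod.fst_neg, Prod.snd_neg, min_val_neg, min_val_neg]

lemma zero_notMem_of_mem_M1 {p : ℕ} {m : Finset (Torus p)} (hm : m ∈ M1 p) : (0 : Torus p) ∉ m := by
  rcases hm with rfl | ⟨r, _, h⟩
  · simp
  · simp [h]

lemma neg_mem_of_mem_M1 {p : ℕ} [NeZero p] {m : Finset (Torus p)} (hm : m ∈ M1 p) {x : Torus p}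
    (hx : x ∈ m) : -x ∈ m := by
  rcases hm with rfl | ⟨r, _, h⟩
  · simp at hx
  · rw [h] at hx ⊢
    rwa [torusNorm_neg, neg_ne_zero]

/-- The models are nested. -/
lemma subset_total_of_mem_M1 {p : ℕ} {m₁ m₂ : Finset (Torus p)} (h₁ : m₁ ∈ M1 p)
    (h₂ : m₂ ∈ M1 p) : m₁ ⊆ m₂ ∨ m₂ ⊆ m₁ := by
  rcases h₁ with rfl | ⟨r, _, h⟩
  · simp
  rcases h₂ with rfl | ⟨r', _, h'⟩
  · simp
  rcases le_total r r' with hr | hr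
  · refine Or.inl fun x hx => ?_
    rw [h] at hx; rw [h']
    exact ⟨hx.1, hx.2.trans hr⟩
  · refine Or.inr fun x hx => ?_
    rw [h'] at hx; rw [h]
    exact ⟨hx.1, hx.2.trans hr⟩

lemma empty_mem_M1 (p : ℕ) : (∅ : Finset (Torus p)) ∈ M1 p := Or.inl rfl

lemma dim_le_card {p : ℕ} (m : Finset (Torus p)) : dim m ≤ m.card := by
  let f : ThetaM m →ₗ[ℝ] (m → ℝ) :=
    { toFun := fun θ x => θ.1 x
      map_add' := fun _ _ => rfl
      map_smul' := fun _ _ => rfl }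
  have hf : Function.Injective f := by
    intro a b hab
    ext x
    by_cases hx : x ∈ m
    · exact congrFun hab ⟨x, hx⟩
    · rw [a.2.2 x hx, b.2.2 x hx]
  have := LinearMap.finrank_le_finrank_of_injective hf
  simpa [dim] using this

/-- In a symmetric neighborhood that avoids `0`, the dimension of `Θ_m` is at least half of the
number of nodes: one coordinate can be chosen freely in each pair `{x, -x}`. -/
lemma card_le_two_mul_dim {p : ℕ} [NeZero p] {m : Finset (Torus p)} (h0 : (0 : Torus p) ∉ m)
    (hneg : ∀ x ∈ m, -x ∈ m) : m.card ≤ 2 * dim m := by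
  classical
  obtain ⟨key, hkey⟩ : ∃ key : Torus p → ℕ, Function.Injective key :=
    ⟨fun x => (Fintype.equivFin (Torus p) x : ℕ),
      fun a b h => (Fintype.equivFin _).injective (Fin.ext h)⟩
  set mh := m.filter fun x => key x ≤ key (-x) with hmh
  have hcard : m.card ≤ 2 * mh.card := by
    have hsub : m ⊆ mh ∪ mh.image (fun x => -x) := by
      intro x hx
      rcases le_total (key x) (key (-x)) with h | h
      · exact mem_union_left _ (mem_filter.2 ⟨hx, h⟩)
      · refine mem_union_right _ (mem_image.2 ⟨-x, mem_filter.2 ⟨hneg x hx, ?_⟩, neg_neg x⟩)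
        rwa [neg_neg]
    calc m.card ≤ _ := card_le_card hsub
      _ ≤ mh.card + (mh.image (fun x => -x)).card := card_union_le _ _
      _ ≤ mh.card + mh.card := Nat.add_le_add_left card_image_le _
      _ = _ := by ring
  let f : ThetaM m →ₗ[ℝ] (mh → ℝ) :=
    { toFun := fun θ x => θ.1 x
      map_add' := fun _ _ => rfl
      map_smul' := fun _ _ => rfl }
  have hf : Function.Surjective f := by
    intro g
    let g' : Torus p → ℝ := fun x => if h : x ∈ mh then g ⟨x, h⟩ else 0
    let θ : Torus p → ℝ := fun x =>
      if x ∈ m then (if key x ≤ key (-x) then g' x else g' (-x)) else 0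
    refine ⟨⟨θ, ⟨⟨by simp [θ, h0], fun x => ?_⟩, fun x hx => by simp [θ, hx]⟩⟩, ?_⟩
    · have hmem : -x ∈ m ↔ x ∈ m := ⟨fun h => by simpa using hneg _ h, hneg x⟩
      simp only [θ, hmem, neg_neg]
      by_cases hx : x ∈ m
      · rcases lt_trichotomy (key x) (key (-x)) with h | h | h
        · simp [hx, h.le, h.not_ge]
        · have := hkey h
          simp [hx, ← this]
        · simp [hx, h.le, h.not_ge]
      · simp [hx]
    · ext ⟨x, hx⟩
      have hx' := mem_filter.1 hx
      change θ x = g ⟨x, hx⟩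
      simp [θ, g', hx'.1, hx'.2, hx]
  have := LinearMap.finrank_le_finrank_of_surjective hf
  have h2 : mh.card ≤ dim m := by simpa [dim] using this
  omega

lemma exists_greatest_model {p : ℕ} [NeZero p] {t : ℝ} (ht : 0 ≤ t) :
    ∃ M ∈ M1 p, (dim M : ℝ) ≤ t ∧ ∀ m ∈ M1 p, (dim m : ℝ) ≤ t → m ⊆ M := by
  classical
  have hd : dim (∅ : Finset (Torus p)) = 0 := by
    have := dim_le_card (∅ : Finset (Torus p))
    simpa using this
  obtain ⟨M, hM, hmax⟩ := Finset.exists_max_image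
    ((univ : Finset (Finset (Torus p))).filter fun m => m ∈ M1 p ∧ (dim m : ℝ) ≤ t) Finset.card
    ⟨∅, by simp [empty_mem_M1, hd, ht]⟩
  simp only [mem_filter, mem_univ, true_and] at hM hmax
  refine ⟨M, hM.1, hM.2, fun m hm hmt => ?_⟩
  rcases subset_total_of_mem_M1 hm hM.1 with h | h
  · exact h
  · exact (Finset.eq_of_subset_of_card_le h (hmax m ⟨hm, hmt⟩)).symm.subset

/-- The disc of radius `R` around `0`, without its center. -/
noncomputable def disc (p : ℕ) [NeZero p] (R : ℕ) : Finset (Torus p) :=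
  open Classical in univ.filter fun x => x ≠ 0 ∧ torusNorm x ≤ R

lemma disc_mem_M1 {p : ℕ} [NeZero p] {R : ℕ} (hR : 2 ≤ R) : disc p R ∈ M1 p := by
  refine Or.inr ⟨R, ?_, fun x => by simp [disc]⟩
  exact_mod_cast hR

lemma min_val_nonneg {p : ℕ} [NeZero p] (a : ZMod p) :
    0 ≤ min (a.val : ℝ) ((p : ℝ) - (a.val : ℝ)) :=
  le_min (by positivity) (sub_nonneg.2 (by exact_mod_cast (ZMod.val_lt a).le))

/-- A disc of radius `R` is included in the image of the square `[-R, R] ^ 2`. -/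
lemma card_disc_le {p : ℕ} [NeZero p] (R : ℕ) : ((disc p R).card : ℝ) ≤ (2 * R + 1) ^ 2 := by
  classical
  set I : Finset (ZMod p) := (Icc (-(R : ℤ)) R).image (fun z : ℤ => (z : ZMod p)) with hI
  have hmem : ∀ a : ZMod p, min (a.val : ℝ) ((p : ℝ) - (a.val : ℝ)) ≤ R → a ∈ I := by
    intro a ha
    rcases min_le_iff.1 ha with h | h
    · have h' : a.val ≤ R := by exact_mod_cast h
      refine mem_image.2 ⟨(a.val : ℤ), mem_Icc.2 ⟨by omega, by omega⟩, by simp⟩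
    · have h' : (p : ℤ) - a.val ≤ R := by exact_mod_cast h
      have := ZMod.val_lt a
      refine mem_image.2 ⟨(a.val : ℤ) - p, mem_Icc.2 ⟨by omega, by omega⟩, by simp⟩
  have hsub : disc p R ⊆ I ×ˢ I := by
    intro x hx
    have hx' : torusNorm x ≤ R := by
      have := hx
      simp only [disc, mem_filter] at this
      exact this.2.2
    unfold torusNorm at hx'
    have h1 := Real.sqrt_le_iff.1 hx'
    refine mem_product.2 ⟨hmem _ ?_, hmem _ ?_⟩
    · exact abs_le_of_sq_le_sq' (by nlinarith [h1.2]) h1.1 |>.2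
    · exact abs_le_of_sq_le_sq' (by nlinarith [h1.2]) h1.1 |>.2
  have hcI : I.card ≤ 2 * R + 1 := by
    refine card_image_le.trans ?_
    rw [Int.card_Icc]; omega
  have : (disc p R).card ≤ (2 * R + 1) ^ 2 := by
    calc (disc p R).card ≤ (I ×ˢ I).card := card_le_card hsub
      _ = I.card * I.card := card_product _ _
      _ ≤ (2 * R + 1) * (2 * R + 1) := Nat.mul_le_mul hcI hcI
      _ = _ := by ring
  exact_mod_cast this

/-- A disc of radius `R` contains the image of the square `[0, s) ^ 2` whenever
`s ≤ R / 2 + 1` and `s ≤ p`. -/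
lemma sq_le_card_disc_add_one {p : ℕ} [NeZero p] {R s : ℕ} (hsp : s ≤ p) (hs : 2 * s ≤ R + 2) :
    s ^ 2 ≤ (disc p R).card + 1 := by
  classical
  have hval : ∀ i < s, ((i : ℕ) : ZMod p).val = i := fun i hi =>
    ZMod.val_natCast_of_lt (hi.trans_le hsp)
  have hsub : (range s ×ˢ range s).image (fun q : ℕ × ℕ => ((q.1 : ZMod p), (q.2 : ZMod p)))
      ⊆ insert 0 (disc p R) := by
    intro x hx
    obtain ⟨⟨i, j⟩, hq, rfl⟩ := mem_image.1 hx
    simp only [mem_product, mem_range] at hq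
    rw [mem_insert]
    by_cases h0 : (((i : ZMod p), (j : ZMod p)) : Torus p) = 0
    · exact Or.inl h0
    · refine Or.inr ?_
      simp only [disc, mem_filter, mem_univ, true_and]
      refine ⟨h0, ?_⟩
      unfold torusNorm
      refine Real.sqrt_le_iff.2 ⟨by positivity, ?_⟩
      have h1 := min_val_nonneg (i : ZMod p)
      have h2 := min_val_nonneg (j : ZMod p)
      have h3 : min (((i : ZMod p).val : ℝ)) ((p : ℝ) - ((i : ZMod p).val : ℝ)) ≤ R / 2 := by
        refine (min_le_left _ _).trans ?_
        rw [hval i hq.1]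
        have : 2 * i ≤ R := by omega
        have : (2 : ℝ) * i ≤ R := by exact_mod_cast this
        linarith
      have h4 : min (((j : ZMod p).val : ℝ)) ((p : ℝ) - ((j : ZMod p).val : ℝ)) ≤ R / 2 := by
        refine (min_le_left _ _).trans ?_
        rw [hval j hq.2]
        have : 2 * j ≤ R := by omega
        have : (2 : ℝ) * j ≤ R := by exact_mod_cast this
        linarith
      have hR : (0 : ℝ) ≤ R := by positivity
      nlinarith [mul_self_le_mul_self h1 h3, mul_self_le_mul_self h2 h4]
  have hcard := card_le_card hsub
  rw [card_image_of_injOn] at hcard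
  · rw [card_product, card_range] at hcard
    calc s ^ 2 = s * s := sq s
      _ ≤ _ := hcard
      _ ≤ _ := card_insert_le _ _
  · rintro ⟨i, j⟩ hq ⟨i', j'⟩ hq' h
    simp only [coe_product, coe_range, Set.mem_prod, Set.mem_Iio] at hq hq'
    simp only [Prod.mk.injEq] at h ⊢
    refine ⟨?_, ?_⟩
    · rw [← hval i hq.1, ← hval i' hq'.1, h.1]
    · rw [← hval j hq.2, ← hval j' hq'.2, h.2]

/-- Discs fill the torus gradually: the largest model with `d_m ≤ N` has a number of nodes
comparable to `N ∧ p ^ 2`. -/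
lemma min_le_mul_card_of_greatest {p : ℕ} [NeZero p] (hp : 2 ≤ p) {N : ℝ} (hN : 32 ≤ N)
    {m' : Finset (Torus p)} (hm' : ∀ m ∈ M1 p, (dim m : ℝ) ≤ N → m ⊆ m') :
    min N ((p : ℝ) ^ 2) ≤ 256 * (m'.card : ℝ) := by
  set R : ℕ := ⌊√(N / 8)⌋₊ with hR
  have hsq : √(N / 8) ^ 2 = N / 8 := Real.sq_sqrt (by linarith)
  have hs2 : 2 ≤ √(N / 8) := Real.le_sqrt_of_sq_le (by linarith)
  have hR2 : 2 ≤ R := Nat.le_floor (by exact_mod_cast hs2)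
  have hRle : (R : ℝ) ≤ √(N / 8) := Nat.floor_le (by positivity)
  have hRlt : √(N / 8) < R + 1 := Nat.lt_floor_add_one _
  have hR2' : (2 : ℝ) ≤ R := by exact_mod_cast hR2
  have hdim : (dim (disc p R) : ℝ) ≤ N := by
    have h1 : (dim (disc p R) : ℝ) ≤ (disc p R).card := by exact_mod_cast dim_le_card _
    refine (h1.trans (card_disc_le R)).trans ?_
    nlinarith [mul_self_le_mul_self (by positivity) hRle]
  have hsub := hm' _ (disc_mem_M1 hR2) hdim
  have hcard : ((disc p R).card : ℝ) ≤ m'.card := by exact_mod_cast card_le_card hsub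
  set s : ℕ := min (R / 2 + 1) p with hs
  have hss := sq_le_card_disc_add_one (p := p) (R := R) (s := s) (min_le_right _ _) (by omega)
  have hs2 : 2 ≤ s := by omega
  have hss' : (s : ℝ) ^ 2 ≤ (disc p R).card + 1 := by exact_mod_cast hss
  have hs2' : (2 : ℝ) ≤ s := by exact_mod_cast hs2
  have key : min N ((p : ℝ) ^ 2) ≤ 128 * (s : ℝ) ^ 2 := by
    rcases le_total (R / 2 + 1) p with h | h
    · have h1 : s = R / 2 + 1 := min_eq_left h
      have h2 : R + 1 ≤ 2 * s := by omega
      have h3 : (R : ℝ) + 1 ≤ 2 * s := by exact_mod_cast h2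
      refine (min_le_left _ _).trans ?_
      nlinarith
    · have h1 : s = p := min_eq_right h
      refine (min_le_right _ _).trans ?_
      rw [h1]
      nlinarith [sq_nonneg (p : ℝ)]
  nlinarith

/-! ### Harmonic analysis on the torus -/

section Fourier

variable {p : ℕ} [NeZero p]

/-- The character `exp (2 i π ⟨ω, l⟩ / p)` of the torus. -/
noncomputable def phase (ω l : Torus p) : ℂ := ZMod.stdAddChar (ω.1 * l.1 + ω.2 * l.2)

/-- `cos (2 π ⟨ω, l⟩ / p)`. -/
noncomputable def tcos (ω l : Torus p) : ℝ := (phase ω l).re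

/-- `sin (2 π ⟨ω, l⟩ / p)`. -/
noncomputable def tsin (ω l : Torus p) : ℝ := (phase ω l).im

lemma phase_comm (ω l : Torus p) : phase ω l = phase l ω := by
  simp only [phase, mul_comm]

lemma tcos_comm (ω l : Torus p) : tcos ω l = tcos l ω := by rw [tcos, phase_comm, tcos]

lemma tsin_comm (ω l : Torus p) : tsin ω l = tsin l ω := by rw [tsin, phase_comm, tsin]

lemma phase_add (ω l l' : Torus p) : phase ω (l + l') = phase ω l * phase ω l' := by
  simp only [phase, ← AddChar.map_add_eq_mul]
  congr 1
  simp only [Prod.fst_add, Prod.snd_add]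
  ring

lemma phase_neg (ω l : Torus p) : phase ω (-l) = (starRingEnd ℂ) (phase ω l) := by
  simp only [phase, ← AddChar.map_neg_eq_conj]
  congr 1
  simp only [Prod.fst_neg, Prod.snd_neg]
  ring

lemma tcos_neg (ω l : Torus p) : tcos ω (-l) = tcos ω l := by simp [tcos, phase_neg]

lemma tsin_neg (ω l : Torus p) : tsin ω (-l) = -tsin ω l := by simp [tsin, phase_neg]

lemma tcos_add (ω l l' : Torus p) :
    tcos ω (l + l') = tcos ω l * tcos ω l' - tsin ω l * tsin ω l' := by
  simp [tcos, tsin, phase_add]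

lemma tsin_add (ω l l' : Torus p) :
    tsin ω (l + l') = tcos ω l * tsin ω l' + tsin ω l * tcos ω l' := by
  simp [tcos, tsin, phase_add]

lemma tcos_zero (ω : Torus p) : tcos ω 0 = 1 := by simp [tcos, phase]

lemma tcos_sq_add_tsin_sq (ω l : Torus p) : tcos ω l ^ 2 + tsin ω l ^ 2 = 1 := by
  have h := tcos_add ω l (-l)
  rw [add_neg_cancel, tcos_zero, tcos_neg, tsin_neg] at h
  linarith

lemma tcos_sq_le_one (ω l : Torus p) : tcos ω l ^ 2 ≤ 1 := by
  nlinarith [tcos_sq_add_tsin_sq ω l, sq_nonneg (tsin ω l)]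

lemma abs_tcos_le_one (ω l : Torus p) : |tcos ω l| ≤ 1 := by
  have := tcos_sq_le_one ω l
  rw [← sq_abs] at this
  nlinarith [abs_nonneg (tcos ω l)]

lemma sum_phase (l : Torus p) : ∑ ω : Torus p, phase ω l = if l = 0 then (p : ℂ) ^ 2 else 0 := by
  have h := fun b : ZMod p =>
    AddChar.sum_mulShift (ψ := (ZMod.stdAddChar (N := p))) b (ZMod.isPrimitive_stdAddChar p)
  have e : ∑ ω : Torus p, phase ω l = (∑ a : ZMod p, ZMod.stdAddChar (a * l.1))
      * ∑ b : ZMod p, ZMod.stdAddChar (b * l.2) := by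
    rw [sum_mul_sum, ← univ_product_univ, sum_product]
    simp [phase, AddChar.map_add_eq_mul]
  rw [e, h, h]
  obtain ⟨l1, l2⟩ := l
  by_cases h1 : l1 = 0 <;> by_cases h2 : l2 = 0 <;> simp [h1, h2, ZMod.card, sq]

lemma sum_tcos (l : Torus p) : ∑ ω : Torus p, tcos ω l = if l = 0 then (p : ℝ) ^ 2 else 0 := by
  have h := congrArg Complex.re (sum_phase l)
  rw [Complex.re_sum] at h
  rw [show ∑ ω : Torus p, tcos ω l = ∑ ω : Torus p, (phase ω l).re from rfl, h]
  split_ifs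
  · norm_cast
  · simp

lemma sum_tsin (l : Torus p) : ∑ ω : Torus p, tsin ω l = 0 := by
  have h := congrArg Complex.im (sum_phase l)
  rw [Complex.im_sum] at h
  rw [show ∑ ω : Torus p, tsin ω l = ∑ ω : Torus p, (phase ω l).im from rfl, h]
  split_ifs
  · norm_cast
  · simp

lemma sum_tcos_mul_tcos (l l' : Torus p) :
    ∑ ω : Torus p, tcos ω l * tcos ω l'
      = (p : ℝ) ^ 2 / 2 * ((if l = l' then 1 else 0) + (if l = -l' then 1 else 0)) := by
  have e : ∀ ω : Torus p, tcos ω l * tcos ω l'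
      = (tcos ω (l + -l') + tcos ω (l + l')) / 2 := by
    intro ω
    rw [tcos_add, tcos_add, tcos_neg, tsin_neg]
    ring
  simp only [e, ← sum_div, sum_add_distrib, sum_tcos, add_eq_zero_iff_eq_neg, neg_neg]
  split_ifs <;> ring

/-- The Fourier transform of a symmetric function on the torus. -/
noncomputable def hat (h : Param p) (ω : Torus p) : ℝ := ∑ l, h l * tcos ω l

lemma hat_add (h g : Param p) (ω : Torus p) : hat (h + g) ω = hat h ω + hat g ω := by
  simp [hat, add_mul, sum_add_distrib]

lemma abs_hat_le (h : Param p) (ω : Torus p) : |hat h ω| ≤ ∑ l, |h l| := by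
  refine (abs_sum_le_sum_abs _ _).trans (sum_le_sum fun l _ => ?_)
  rw [abs_mul]
  exact mul_le_of_le_one_right (abs_nonneg _) (abs_tcos_le_one ω l)

lemma sum_hat (h : Param p) : ∑ ω, hat h ω = (p : ℝ) ^ 2 * h 0 := by
  simp only [hat]
  rw [sum_comm]
  simp only [← mul_sum, sum_tcos]
  simp [mul_comm]

/-- Parseval's identity. -/
lemma sum_hat_sq {h : Param p} (hs : ∀ x, h (-x) = h x) :
    ∑ ω, hat h ω ^ 2 = (p : ℝ) ^ 2 * ∑ l, h l ^ 2 := by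
  have e : ∀ ω, hat h ω ^ 2 = ∑ l, ∑ l', h l * h l' * (tcos ω l * tcos ω l') := by
    intro ω
    rw [sq, hat, sum_mul_sum]
    exact sum_congr rfl fun l _ => sum_congr rfl fun l' _ => by ring
  simp only [e]
  rw [sum_comm, mul_sum]
  refine sum_congr rfl fun l _ => ?_
  rw [sum_comm]
  simp only [← mul_sum, sum_tcos_mul_tcos, mul_add, sum_add_distrib]
  have e2 : ∀ x : Torus p, (l = -x) = (x = -l) := fun x =>
    propext ⟨fun h => by rw [h, neg_neg], fun h => by rw [h, neg_neg]⟩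
  simp only [e2]
  simp [hs]
  ring

lemma sum_mul_tsin {h : Param p} (hs : ∀ x, h (-x) = h x) (ω : Torus p) :
    ∑ l, h l * tsin ω l = 0 := by
  have e : ∑ l, h l * tsin ω l = ∑ l, h (-l) * tsin ω (-l) :=
    (Equiv.sum_comp (Equiv.neg (Torus p)) fun l => h l * tsin ω l).symm
  simp only [hs, tsin_neg, mul_neg, sum_neg_distrib] at e
  linarith

/-- The Hartley matrix, with entries `(cos + sin) (2 π ⟨ω, l⟩ / p) / p`. It is real, symmetric and
orthogonal, and it diagonalizes the matrices `C(θ)`, `θ ∈ Θ`. -/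
noncomputable def hartley (p : ℕ) [NeZero p] : Matrix (Torus p) (Torus p) ℝ :=
  Matrix.of fun ω l => (tcos ω l + tsin ω l) / p

lemma hartley_comm (ω l : Torus p) : hartley p ω l = hartley p l ω := by
  simp [hartley, tcos_comm ω l, tsin_comm ω l]

lemma hartley_mul_self : hartley p * hartley p = 1 := by
  ext x y
  have hp : (p : ℝ) ≠ 0 := NeZero.ne _
  have e : ∀ ω : Torus p, hartley p x ω * hartley p ω y
      = (tcos ω (x + -y) + tsin ω (x + y)) / (p : ℝ) ^ 2 := by
    intro ω
    rw [hartley_comm x ω, tcos_add, tsin_add, tcos_neg, tsin_neg]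
    simp only [hartley, Matrix.of_apply]
    field_simp
    ring
  rw [Matrix.mul_apply, Matrix.one_apply]
  simp only [e, ← sum_div, sum_add_distrib, sum_tcos, sum_tsin, add_neg_eq_zero]
  split_ifs <;> simp [hp]

lemma sum_hartley_mul_hartley (ω ω' : Torus p) :
    ∑ j, hartley p ω j * hartley p ω' j = if ω = ω' then 1 else 0 := by
  have h := congrFun (congrFun (hartley_mul_self (p := p)) ω) ω'
  rw [Matrix.mul_apply, Matrix.one_apply] at h
  rw [← h]
  exact sum_congr rfl fun j _ => by rw [hartley_comm ω' j]

/-- The rows of the Hartley matrix are eigenvectors of the convolutions by symmetric functions. -/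
lemma sum_mul_hartley_add {h : Param p} (hs : ∀ x, h (-x) = h x) (ω j : Torus p) :
    ∑ l, h l * hartley p ω (j + l) = hat h ω * hartley p ω j := by
  have e : ∀ l, h l * hartley p ω (j + l) = h l * tcos ω l * hartley p ω j
      + h l * tsin ω l * ((tcos ω j - tsin ω j) / p) := by
    intro l
    simp only [hartley, Matrix.of_apply, tcos_add, tsin_add]
    ring
  simp only [e, sum_add_distrib, ← sum_mul, sum_mul_tsin hs, hat, zero_mul, add_zero]

lemma sum_sq_sum_mul_hartley (b : Torus p → ℝ) :
    ∑ j, (∑ ω, b ω * hartley p ω j) ^ 2 = ∑ ω, b ω ^ 2 := by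
  have e : ∀ j, (∑ ω, b ω * hartley p ω j) ^ 2
      = ∑ ω, ∑ ω', b ω * b ω' * (hartley p ω j * hartley p ω' j) := by
    intro j
    rw [sq, sum_mul_sum]
    exact sum_congr rfl fun l _ => sum_congr rfl fun l' _ => by ring
  simp only [e]
  rw [sum_comm]
  refine sum_congr rfl fun ω _ => ?_
  rw [sum_comm]
  simp only [← mul_sum, sum_hartley_mul_hartley]
  simp [sq]

lemma one_sub_C_eq {θ : Param p} (hs : ∀ x, θ (-x) = θ x) :
    1 - C θ = hartley p * Matrix.diagonal (fun ω => 1 - hat θ ω) * hartley p := by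
  have h1 : C θ * hartley p = hartley p * Matrix.diagonal (hat θ) := by
    ext x ω
    rw [Matrix.mul_apply, Matrix.mul_diagonal, mul_comm, hartley_comm x ω,
      ← sum_mul_hartley_add hs, ← Equiv.sum_comp (Equiv.addLeft x)]
    refine sum_congr rfl fun l _ => ?_
    rw [hartley_comm ω]
    simp [C]
  have h2 : C θ = hartley p * Matrix.diagonal (hat θ) * hartley p := by
    rw [← h1, mul_assoc, hartley_mul_self, mul_one]
  have h3 : Matrix.diagonal (fun ω => 1 - hat θ ω) = 1 - Matrix.diagonal (hat θ) := by
    rw [← Matrix.diagonal_one, Matrix.diagonal_sub]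
  rw [h3, mul_sub, sub_mul, ← h2, mul_one, hartley_mul_self]

lemma spectrum_one_sub_C {θ : Param p} (hs : ∀ x, θ (-x) = θ x) :
    spectrum ℝ (1 - C θ) = Set.range fun ω => 1 - hat θ ω := by
  let U : (Matrix (Torus p) (Torus p) ℝ)ˣ :=
    ⟨hartley p, hartley p, hartley_mul_self, hartley_mul_self⟩
  have h : 1 - C θ = U * Matrix.diagonal (fun ω => 1 - hat θ ω) * (U⁻¹ : _ˣ) := one_sub_C_eq hs
  rw [h, spectrum.units_conjugate, spectrum_diagonal]

lemma posDef_one_sub_C_iff {θ : Param p} (hs : ∀ x, θ (-x) = θ x) :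
    (1 - C θ).PosDef ↔ ∀ ω, hat θ ω < 1 := by
  have hstar : star (hartley p) = hartley p := by
    ext x y
    simp [Matrix.star_apply, hartley_comm x y]
  have hU : IsUnit (hartley p) :=
    ⟨⟨hartley p, hartley p, hartley_mul_self, hartley_mul_self⟩, rfl⟩
  have h := Matrix.IsUnit.posDef_star_left_conjugate_iff hU
    (x := Matrix.diagonal fun ω => 1 - hat θ ω)
  rw [hstar, ← one_sub_C_eq hs, Matrix.posDef_diagonal_iff] at h
  simpa using h

lemma one_sub_hat_le_phiMax {θ : Param p} (hs : ∀ x, θ (-x) = θ x) (ω : Torus p) :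
    1 - hat θ ω ≤ phiMax (1 - C θ) := by
  rw [phiMax, spectrum_one_sub_C hs]
  exact le_csSup (Set.finite_range _).bddAbove ⟨ω, rfl⟩

lemma phiMin_le_one_sub_hat {θ : Param p} (hs : ∀ x, θ (-x) = θ x) (ω : Torus p) :
    phiMin (1 - C θ) ≤ 1 - hat θ ω := by
  rw [phiMin, spectrum_one_sub_C hs]
  exact csInf_le (Set.finite_range _).bddBelow ⟨ω, rfl⟩

lemma exists_phiMax_eq {θ : Param p} (hs : ∀ x, θ (-x) = θ x) :
    ∃ ω, phiMax (1 - C θ) = 1 - hat θ ω := by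
  rw [phiMax, spectrum_one_sub_C hs]
  obtain ⟨ω, h⟩ := (Set.range_nonempty _).csSup_mem (Set.finite_range fun ω => 1 - hat θ ω)
  exact ⟨ω, h.symm⟩

lemma exists_phiMin_eq {θ : Param p} (hs : ∀ x, θ (-x) = θ x) :
    ∃ ω, phiMin (1 - C θ) = 1 - hat θ ω := by
  rw [phiMin, spectrum_one_sub_C hs]
  obtain ⟨ω, h⟩ := (Set.range_nonempty _).csInf_mem (Set.finite_range fun ω => 1 - hat θ ω)
  exact ⟨ω, h.symm⟩

lemma mem_ThetaPlus_iff {ρ : ℝ} {m : Finset (Torus p)} {θ : Param p} :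
    θ ∈ ThetaPlus ρ m ↔ θ ∈ ThetaM m ∧ ∀ ω, hat θ ω < 1 ∧ 1 - hat θ ω < ρ := by
  refine and_congr_right fun hθ => ?_
  have hs := hθ.1.2
  rw [posDef_one_sub_C_iff hs, forall_and]
  refine and_congr_right fun _ => ⟨fun h ω => (one_sub_hat_le_phiMax hs ω).trans_lt h, fun h => ?_⟩
  obtain ⟨ω, hω⟩ := exists_phiMax_eq hs
  rw [hω]
  exact h ω

lemma closure_ThetaPlus_subset {ρ : ℝ} {m : Finset (Torus p)} :
    closure (ThetaPlus ρ m) ⊆ (ThetaM m : Set (Param p)) :=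
  closure_minimal (fun _ h => h.1) (ThetaM m).closed_of_finiteDimensional

end Fourier

/-! ### The law of the sample in the Hartley basis -/

section Law

variable {p : ℕ} [NeZero p]

/-- The rows of the Hartley matrix, as an orthonormal basis. -/
noncomputable def hartleyBasis (p : ℕ) [NeZero p] :
    OrthonormalBasis (Torus p) ℝ (EuclideanSpace ℝ (Torus p)) :=
  have h : Orthonormal ℝ fun ω : Torus p => WithLp.toLp 2 (hartley p ω) := by
    rw [orthonormal_iff_ite]
    intro ω ω'
    rw [← sum_hartley_mul_hartley]
    simp [PiLp.inner_apply, mul_comm]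
  (basisOfOrthonormalOfCardEqFinrank h (by simp)).toOrthonormalBasis (by simpa using h)

lemma hartleyBasis_apply (ω j : Torus p) : hartleyBasis p ω j = hartley p ω j := by
  simp [hartleyBasis]

/-- The field with coordinates `σ w ω / √(1 - hat θ ω)` in the Hartley basis. For standard
Gaussian `w`, this is a Gaussian field with covariance matrix `σ² (I - C(θ))⁻¹`. -/
noncomputable def fieldOf (σ : ℝ) (θ : Param p) (w : Torus p → ℝ) : EuclideanSpace ℝ (Torus p) :=
  WithLp.toLp 2 fun j => ∑ ω, w ω * (σ / √(1 - hat θ ω)) * hartley p ω j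

lemma measurable_fieldOf (σ : ℝ) (θ : Param p) : Measurable (fieldOf σ θ) := by
  unfold fieldOf
  fun_prop

open scoped MatrixOrder in
lemma sqrt_covMat {σ : ℝ} (hσ : 0 < σ) {θ : Param p} (hs : ∀ x, θ (-x) = θ x)
    (hθ : ∀ ω, hat θ ω < 1) :
    CFC.sqrt (covMat σ θ)
      = hartley p * Matrix.diagonal (fun ω => σ / √(1 - hat θ ω)) * hartley p := by
  set B := hartley p * Matrix.diagonal (fun ω => σ / √(1 - hat θ ω)) * hartley p with hB
  have hstar : (hartley p).conjTranspose = hartley p := by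
    ext x y
    simp [Matrix.conjTranspose_apply, hartley_comm x y]
  have hBpos : B.PosSemidef := by
    have hd : (Matrix.diagonal (fun ω => σ / √(1 - hat θ ω))).PosSemidef :=
      Matrix.PosSemidef.diagonal fun ω => by positivity
    have := hd.conjTranspose_mul_mul_same (hartley p)
    rwa [hstar] at this
  have hpos : ∀ ω, 0 < 1 - hat θ ω := fun ω => sub_pos.2 (hθ ω)
  have hinv : (1 - C θ)⁻¹
      = hartley p * Matrix.diagonal (fun ω => (1 - hat θ ω)⁻¹) * hartley p := by
    refine Matrix.inv_eq_right_inv ?_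
    rw [one_sub_C_eq hs]
    calc _ = hartley p * Matrix.diagonal (fun ω => 1 - hat θ ω) * (hartley p * hartley p)
          * Matrix.diagonal (fun ω => (1 - hat θ ω)⁻¹) * hartley p := by
          simp only [mul_assoc]
      _ = hartley p * (Matrix.diagonal (fun ω => 1 - hat θ ω)
          * Matrix.diagonal (fun ω => (1 - hat θ ω)⁻¹)) * hartley p := by
          rw [hartley_mul_self]; simp only [mul_assoc, one_mul]
      _ = 1 := by
          rw [Matrix.diagonal_mul_diagonal]
          simp only [mul_inv_cancel₀ (hpos _).ne', Matrix.diagonal_one, mul_one,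
            hartley_mul_self]
  have hBB : B * B = covMat σ θ := by
    calc B * B = hartley p * Matrix.diagonal (fun ω => σ / √(1 - hat θ ω))
          * (hartley p * hartley p)
          * Matrix.diagonal (fun ω => σ / √(1 - hat θ ω)) * hartley p := by
          simp only [hB, mul_assoc]
      _ = hartley p * (Matrix.diagonal (fun ω => σ / √(1 - hat θ ω))
          * Matrix.diagonal (fun ω => σ / √(1 - hat θ ω))) * hartley p := by
          rw [hartley_mul_self]; simp only [mul_assoc, one_mul]
      _ = hartley p * (σ ^ 2 • Matrix.diagonal (fun ω => (1 - hat θ ω)⁻¹)) * hartley p := by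
          rw [Matrix.diagonal_mul_diagonal, ← Matrix.diagonal_smul]
          congr 3
          ext ω
          simp only [Pi.smul_apply, smul_eq_mul]
          rw [div_mul_div_comm, Real.mul_self_sqrt (hpos ω).le, ← sq, div_eq_mul_inv]
      _ = covMat σ θ := by
          rw [covMat, hinv, Matrix.mul_smul, Matrix.smul_mul]
  exact CFC.sqrt_unique hBB hBpos.nonneg

lemma multivariateGaussian_covMat {σ : ℝ} (hσ : 0 < σ) {θ : Param p} (hs : ∀ x, θ (-x) = θ x)
    (hθ : ∀ ω, hat θ ω < 1) :
    multivariateGaussian 0 (covMat σ θ)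
      = (Measure.pi fun _ : Torus p => gaussianReal 0 1).map (fieldOf σ θ) := by
  rw [multivariateGaussian, sqrt_covMat hσ hs hθ,
    stdGaussian_eq_map_pi_orthonormalBasis (hartleyBasis p), Measure.map_map]
  · congr 1
    ext w j
    simp only [Function.comp_apply, zero_add, map_sum, map_smul, fieldOf, WithLp.ofLp_sum,
      Finset.sum_apply, WithLp.ofLp_smul, Pi.smul_apply, smul_eq_mul, mul_assoc]
    refine sum_congr rfl fun ω _ => ?_
    congr 1
    rw [Matrix.ofLp_toEuclideanCLM]
    have e1 : (hartleyBasis p ω).ofLp = hartley p ω := by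
      ext j; exact hartleyBasis_apply ω j
    have e2 : Matrix.mulVec (hartley p) (hartley p ω) = Pi.single ω 1 := by
      ext x
      simp only [Matrix.mulVec, dotProduct, sum_hartley_mul_hartley, Pi.single_apply]
    rw [e1, ← Matrix.mulVec_mulVec, ← Matrix.mulVec_mulVec, e2]
    simp [Matrix.mulVec, dotProduct, Matrix.diagonal_apply,
      hartley_comm j, mul_comm, Pi.single_apply]
  · fun_prop
  · fun_prop

/-- The sample is an explicit function of `n p²` independent standard Gaussian variables. -/
lemma sampleLaw_eq_map (n : ℕ) {σ : ℝ} (hσ : 0 < σ) {θ : Param p} (hs : ∀ x, θ (-x) = θ x)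
    (hθ : ∀ ω, hat θ ω < 1) :
    sampleLaw n σ θ = (Measure.pi fun _ : Fin n × Torus p => gaussianReal 0 1).map
      (fun w k => fieldOf σ θ fun ω => w (k, ω)) := by
  have h1 : (Measure.pi fun _ : Fin n × Torus p => gaussianReal 0 1).map
      (MeasurableEquiv.curry (Fin n) (Torus p) ℝ)
      = Measure.pi fun _ : Fin n => Measure.pi fun _ : Torus p => gaussianReal 0 1 := by
    have := Measure.infinitePi_map_curry (fun (_ : Fin n) (_ : Torus p) => gaussianReal 0 1)
    simpa only [Measure.infinitePi_eq_pi] using this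
  have h2 : ∀ _ : Fin n, MeasurePreserving (fieldOf σ θ)
      (Measure.pi fun _ : Torus p => gaussianReal 0 1) (multivariateGaussian 0 (covMat σ θ)) :=
    fun _ => ⟨measurable_fieldOf σ θ, (multivariateGaussian_covMat hσ hs hθ).symm⟩
  have h3 := (measurePreserving_pi _ _ h2).map_eq
  rw [sampleLaw, ← h3, ← h1, Measure.map_map]
  · rfl
  · exact measurable_pi_lambda _ fun k => (measurable_fieldOf σ θ).comp (measurable_pi_apply k)
  · exact (MeasurableEquiv.curry (Fin n) (Torus p) ℝ).measurable

/-- The periodogram fluctuations `∑ₖ (w (k, ω) ^ 2 - 1)`. -/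
def fluct {n : ℕ} (w : Fin n × Torus p → ℝ) (ω : Torus p) : ℝ := ∑ k, (w (k, ω) ^ 2 - 1)

/-- The least squares criterion in spectral coordinates, up to the factor `σ² / (n p²)`. -/
noncomputable def specCrit (n : ℕ) (θ : Param p) (Y : Torus p → ℝ) (θ' : Param p) : ℝ :=
  ∑ ω, (1 - hat θ' ω) ^ 2 / (1 - hat θ ω) * (n + Y ω)

lemma gammaCLS_eq {n : ℕ} {σ : ℝ} {θ : Param p} (hθ : ∀ ω, hat θ ω < 1)
    {θ' : Param p} (hθ' : θ' ∈ Theta p) (w : Fin n × Torus p → ℝ) :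
    gammaCLS (fun k => fieldOf σ θ fun ω => w (k, ω)) θ'
      = σ ^ 2 / ((n : ℝ) * (p : ℝ) ^ 2) * specCrit n θ (fluct w) θ' := by
  have hpos : ∀ ω, 0 < 1 - hat θ ω := fun ω => sub_pos.2 (hθ ω)
  have hres : ∀ (k : Fin n) (j : Torus p),
      (fieldOf σ θ fun ω => w (k, ω)) j - ∑ l ∈ (univ : Finset (Torus p)).erase 0,
        θ' l * (fieldOf σ θ fun ω => w (k, ω)) (j + l)
      = ∑ ω, (w (k, ω) * (σ / √(1 - hat θ ω)) * (1 - hat θ' ω)) * hartley p ω j := by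
    intro k j
    rw [sum_erase _ (by rw [hθ'.1, zero_mul])]
    have e : ∑ l, θ' l * (fieldOf σ θ fun ω => w (k, ω)) (j + l)
        = ∑ ω, w (k, ω) * (σ / √(1 - hat θ ω)) * (hat θ' ω * hartley p ω j) := by
      simp only [fieldOf, mul_sum, ← sum_mul_hartley_add hθ'.2]
      rw [sum_comm]
      exact sum_congr rfl fun ω _ => sum_congr rfl fun l _ => by ring
    rw [e]
    simp only [fieldOf]
    rw [← sum_sub_distrib]
    exact sum_congr rfl fun ω _ => by ring
  simp only [gammaCLS, hres, sum_sq_sum_mul_hartley, specCrit]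
  rw [sum_comm, mul_sum, mul_sum]
  refine sum_congr rfl fun ω _ => ?_
  have e : ((n : ℝ) + fluct w ω) = ∑ k, w (k, ω) ^ 2 := by
    simp [fluct]
  rw [e, mul_sum, mul_sum, mul_sum]
  refine sum_congr rfl fun k _ => ?_
  rw [mul_pow, mul_pow, div_pow, Real.sq_sqrt (hpos ω).le]
  ring

end Law

/-! ### Control of the fluctuations by second moments -/

section Fluctuations

variable {p : ℕ} [NeZero p]

/-- The total square of the linear statistics `∑ f i ω Y ω`, `i ∈ I`. -/
def linSq {κ : Type*} (I : Finset κ) (f : κ → Torus p → ℝ) (Y : Torus p → ℝ) : ℝ :=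
  ∑ i ∈ I, (∑ ω, f i ω * Y ω) ^ 2

/-- The squared Frobenius norm of the Gram-type matrix with entries `∑ f i ω f j ω Y ω`. -/
def quadSq {κ : Type*} (I : Finset κ) (f : κ → Torus p → ℝ) (Y : Torus p → ℝ) : ℝ :=
  ∑ i ∈ I, ∑ j ∈ I, (∑ ω, f i ω * f j ω * Y ω) ^ 2

lemma linSq_nonneg {κ : Type*} (I : Finset κ) (f : κ → Torus p → ℝ) (Y : Torus p → ℝ) :
    0 ≤ linSq I f Y := sum_nonneg fun _ _ => sq_nonneg _

lemma quadSq_nonneg {κ : Type*} (I : Finset κ) (f : κ → Torus p → ℝ) (Y : Torus p → ℝ) :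
    0 ≤ quadSq I f Y := sum_nonneg fun _ _ => sum_nonneg fun _ _ => sq_nonneg _

lemma sq_sum_mul_le_linSq {κ : Type*} (I : Finset κ) (f : κ → Torus p → ℝ) (Y : Torus p → ℝ)
    (a : κ → ℝ) :
    (∑ ω, (∑ i ∈ I, a i * f i ω) * Y ω) ^ 2 ≤ (∑ i ∈ I, a i ^ 2) * linSq I f Y := by
  have e : ∑ ω, (∑ i ∈ I, a i * f i ω) * Y ω = ∑ i ∈ I, a i * ∑ ω, f i ω * Y ω := by
    simp only [sum_mul, mul_sum]
    rw [sum_comm]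
    exact sum_congr rfl fun i _ => sum_congr rfl fun ω _ => by ring
  rw [e]
  exact sum_mul_sq_le_sq_mul_sq I a _

lemma sq_sum_sq_mul_le_quadSq {κ : Type*} (I : Finset κ) (f : κ → Torus p → ℝ) (Y : Torus p → ℝ)
    (a : κ → ℝ) :
    (∑ ω, (∑ i ∈ I, a i * f i ω) ^ 2 * Y ω) ^ 2 ≤ (∑ i ∈ I, a i ^ 2) ^ 2 * quadSq I f Y := by
  have e : ∑ ω, (∑ i ∈ I, a i * f i ω) ^ 2 * Y ω
      = ∑ q ∈ I ×ˢ I, (a q.1 * a q.2) * ∑ ω, f q.1 ω * f q.2 ω * Y ω := by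
    simp only [sq, sum_mul, mul_sum, sum_product]
    rw [sum_comm]
    refine sum_congr rfl fun i _ => ?_
    rw [sum_comm]
    exact sum_congr rfl fun j _ => sum_congr rfl fun ω _ => by ring
  have e2 : (∑ i ∈ I, a i ^ 2) ^ 2 = ∑ q ∈ I ×ˢ I, (a q.1 * a q.2) ^ 2 := by
    rw [sq, sum_mul_sum, sum_product]
    exact sum_congr rfl fun i _ => sum_congr rfl fun j _ => by ring
  rw [e, e2, quadSq, ← sum_product (s := I) (t := I)
    (f := fun q : κ × κ => (∑ ω, f q.1 ω * f q.2 ω * Y ω) ^ 2)]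
  exact sum_mul_sq_le_sq_mul_sq _ _ _

lemma sum_snd_eq (n : ℕ) (g : Torus p → ℝ) :
    ∑ q : Fin n × Torus p, g q.2 = n * ∑ ω, g ω := by
  rw [Fintype.sum_prod_type (f := fun q : Fin n × Torus p => g q.2)]
  simp only [sum_const, card_univ, Fintype.card_fin, nsmul_eq_mul]

lemma sum_mul_fluct {n : ℕ} (g : Torus p → ℝ) (w : Fin n × Torus p → ℝ) :
    ∑ ω, g ω * fluct w ω = ∑ q : Fin n × Torus p, g q.2 * (w q ^ 2 - 1) := by
  rw [Fintype.sum_prod_type (f := fun q : Fin n × Torus p => g q.2 * (w q ^ 2 - 1)), sum_comm]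
  simp only [fluct, mul_sum]

lemma integrable_sum_mul_fluct_sq (n : ℕ) (g : Torus p → ℝ) :
    Integrable (fun w : Fin n × Torus p → ℝ => (∑ ω, g ω * fluct w ω) ^ 2)
      (Measure.pi fun _ => gaussianReal 0 1) := by
  have h := integrable_linForm_sq (ι := Fin n × Torus p) (u := fun x : ℝ => x ^ 2 - 1)
    (ν := gaussianReal 0 1) integrable_sq_sub_one_pow_gaussianReal fun q => g q.2
  simpa only [sum_mul_fluct] using h

lemma integral_sum_mul_fluct_sq (n : ℕ) (g : Torus p → ℝ) :
    ∫ w : Fin n × Torus p → ℝ, (∑ ω, g ω * fluct w ω) ^ 2 ∂(Measure.pi fun _ => gaussianReal 0 1)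
      = 2 * (n * ∑ ω, g ω ^ 2) := by
  have h := integral_linForm_sq (ι := Fin n × Torus p) (u := fun x : ℝ => x ^ 2 - 1)
    (ν := gaussianReal 0 1) integrable_sq_sub_one_pow_gaussianReal
    integral_sq_sub_one_gaussianReal integral_sq_sub_one_sq_gaussianReal fun q => g q.2
  rw [sum_snd_eq n fun ω => g ω ^ 2] at h
  simpa only [sum_mul_fluct] using h

lemma integrable_linSq {κ : Type*} (n : ℕ) (I : Finset κ) (f : κ → Torus p → ℝ) :
    Integrable (fun w : Fin n × Torus p → ℝ => linSq I f (fluct w))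
      (Measure.pi fun _ => gaussianReal 0 1) :=
  integrable_finsetSum _ fun i _ => integrable_sum_mul_fluct_sq n (f i)

lemma integral_linSq {κ : Type*} (n : ℕ) (I : Finset κ) (f : κ → Torus p → ℝ) :
    ∫ w : Fin n × Torus p → ℝ, linSq I f (fluct w) ∂(Measure.pi fun _ => gaussianReal 0 1)
      = 2 * (n * ∑ i ∈ I, ∑ ω, f i ω ^ 2) := by
  simp only [linSq]
  rw [integral_finsetSum _ fun i _ => integrable_sum_mul_fluct_sq n (f i)]
  simp only [integral_sum_mul_fluct_sq, mul_sum]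

lemma integrable_quadSq {κ : Type*} (n : ℕ) (I : Finset κ) (f : κ → Torus p → ℝ) :
    Integrable (fun w : Fin n × Torus p → ℝ => quadSq I f (fluct w))
      (Measure.pi fun _ => gaussianReal 0 1) :=
  integrable_finsetSum _ fun i _ => integrable_finsetSum _ fun j _ =>
    integrable_sum_mul_fluct_sq n fun ω => f i ω * f j ω

lemma integral_quadSq {κ : Type*} (n : ℕ) (I : Finset κ) (f : κ → Torus p → ℝ) :
    ∫ w : Fin n × Torus p → ℝ, quadSq I f (fluct w) ∂(Measure.pi fun _ => gaussianReal 0 1)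
      = 2 * (n * ∑ i ∈ I, ∑ j ∈ I, ∑ ω, (f i ω * f j ω) ^ 2) := by
  simp only [quadSq]
  rw [integral_finsetSum _ fun i _ => integrable_finsetSum _ fun j _ =>
    integrable_sum_mul_fluct_sq n fun ω => f i ω * f j ω]
  have : ∀ i, ∫ w : Fin n × Torus p → ℝ, ∑ j ∈ I, (∑ ω, f i ω * f j ω * fluct w ω) ^ 2
      ∂(Measure.pi fun _ => gaussianReal 0 1)
      = ∑ j ∈ I, 2 * (n * ∑ ω, (f i ω * f j ω) ^ 2) := by
    intro i
    rw [integral_finsetSum _ fun j _ => integrable_sum_mul_fluct_sq n fun ω => f i ω * f j ω]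
    simp only [integral_sum_mul_fluct_sq n fun ω => f i ω * f _ ω]
  simp only [this, mul_sum]

/-- The variance of a sum of squares of linear statistics. -/
lemma integral_linSq_sub_sq {κ : Type*} (n : ℕ) (I : Finset κ) (f : κ → Torus p → ℝ) :
    Integrable (fun w : Fin n × Torus p → ℝ =>
        (linSq I f (fluct w) - 2 * (n * ∑ i ∈ I, ∑ ω, f i ω ^ 2)) ^ 2)
      (Measure.pi fun _ => gaussianReal 0 1) ∧
    ∫ w : Fin n × Torus p → ℝ, (linSq I f (fluct w) - 2 * (n * ∑ i ∈ I, ∑ ω, f i ω ^ 2)) ^ 2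
        ∂(Measure.pi fun _ => gaussianReal 0 1)
      = 8 * (n ^ 2 * ∑ i ∈ I, ∑ j ∈ I, (∑ ω, f i ω * f j ω) ^ 2)
        + 48 * (n * ∑ ω, (∑ i ∈ I, f i ω ^ 2) ^ 2) := by
  classical
  set G : Fin n × Torus p → Fin n × Torus p → ℝ := fun q q' => ∑ i ∈ I, f i q.2 * f i q'.2 with hG
  have e1 : ∀ w : Fin n × Torus p → ℝ, linSq I f (fluct w)
      = ∑ q, ∑ q', G q q' * ((w q ^ 2 - 1) * (w q' ^ 2 - 1)) := by
    intro w
    have e : ∀ i, (∑ ω, f i ω * fluct w ω) ^ 2 = ∑ q, ∑ q',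
        f i q.2 * f i q'.2 * ((w q ^ 2 - 1) * (w q' ^ 2 - 1)) := fun i => by
      rw [sum_mul_fluct]
      exact linForm_sq (u := fun x : ℝ => x ^ 2 - 1) w fun q => f i q.2
    simp only [linSq, e, hG]
    rw [sum_comm]
    refine sum_congr rfl fun q _ => ?_
    rw [sum_comm]
    exact sum_congr rfl fun q' _ => by rw [sum_mul]
  have e2 : (n : ℝ) * ∑ i ∈ I, ∑ ω, f i ω ^ 2 = ∑ q, G q q := by
    rw [sum_snd_eq n fun ω => ∑ i ∈ I, f i ω * f i ω, sum_comm]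
    simp only [sq]
  have e3 : (n : ℝ) ^ 2 * ∑ i ∈ I, ∑ j ∈ I, (∑ ω, f i ω * f j ω) ^ 2 = ∑ q, ∑ q', G q q' ^ 2 := by
    have e : ∀ q, ∑ q', G q q' ^ 2 = n * ∑ ω', (∑ i ∈ I, f i q.2 * f i ω') ^ 2 := fun q =>
      sum_snd_eq n fun ω' => (∑ i ∈ I, f i q.2 * f i ω') ^ 2
    simp only [e]
    rw [sum_snd_eq n fun ω => n * ∑ ω', (∑ i ∈ I, f i ω * f i ω') ^ 2, ← mul_sum, ← mul_assoc,
      ← sq]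
    congr 1
    calc ∑ i ∈ I, ∑ j ∈ I, (∑ ω, f i ω * f j ω) ^ 2
        = ∑ q ∈ I ×ˢ I, ∑ r ∈ univ ×ˢ univ,
            f q.1 r.1 * f q.2 r.1 * (f q.1 r.2 * f q.2 r.2) := by
          rw [sum_product]
          refine sum_congr rfl fun i _ => sum_congr rfl fun j _ => ?_
          rw [sum_product, sq, sum_mul_sum]
      _ = ∑ r ∈ univ ×ˢ univ, ∑ q ∈ I ×ˢ I,
            f q.1 r.1 * f q.2 r.1 * (f q.1 r.2 * f q.2 r.2) := sum_comm
      _ = ∑ ω, ∑ ω', (∑ i ∈ I, f i ω * f i ω') ^ 2 := by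
          rw [sum_product]
          refine sum_congr rfl fun ω _ => sum_congr rfl fun ω' _ => ?_
          rw [sum_product, sq, sum_mul_sum]
          exact sum_congr rfl fun i _ => sum_congr rfl fun j _ => by ring
  have e4 : (n : ℝ) * ∑ ω, (∑ i ∈ I, f i ω ^ 2) ^ 2 = ∑ q, G q q ^ 2 := by
    rw [sum_snd_eq n fun ω => (∑ i ∈ I, f i ω * f i ω) ^ 2]
    simp only [sq]
  have h := integral_quadForm_sub_sq (ι := Fin n × Torus p) (u := fun x : ℝ => x ^ 2 - 1)
    (ν := gaussianReal 0 1) integrable_sq_sub_one_pow_gaussianReal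
    integral_sq_sub_one_gaussianReal integral_sq_sub_one_sq_gaussianReal
    integral_sq_sub_one_pow_four_gaussianReal G
    (fun q q' => sum_congr rfl fun i _ => mul_comm _ _)
  simp only [e1, e2, e3, e4]
  refine ⟨h.1, h.2.trans ?_⟩
  norm_num

/-- The variance of the sum over a set of nodes of the squared empirical autocovariances is small
compared to the square of its mean. -/
lemma integral_linSq_tcos_sub_sq_le (n : ℕ) (A : Finset (Torus p)) :
    ∫ w : Fin n × Torus p → ℝ, (linSq A (fun l ω => tcos ω l) (fluct w)
        - 2 * (n * ∑ l ∈ A, ∑ ω, tcos ω l ^ 2)) ^ 2 ∂(Measure.pi fun _ => gaussianReal 0 1)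
      ≤ 8 * (n ^ 2 * (A.card * (p : ℝ) ^ 4)) + 48 * (n * ((p : ℝ) ^ 2 * (A.card : ℝ) ^ 2)) := by
  rw [(integral_linSq_sub_sq n A fun l ω => tcos ω l).2]
  gcongr
  · rw [← nsmul_eq_mul]
    refine sum_le_card_nsmul _ _ _ fun l _ => ?_
    have h1 : ∀ l', (∑ ω : Torus p, tcos ω l * tcos ω l') ^ 2
        ≤ (p : ℝ) ^ 4 / 2 * ((if l = l' then 1 else 0) + (if l' = -l then 1 else 0)) := by
      intro l'
      have e : (l = -l') = (l' = -l) :=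
        propext ⟨fun h => by rw [h, neg_neg], fun h => by rw [h, neg_neg]⟩
      simp only [sum_tcos_mul_tcos, e]
      have : (0 : ℝ) ≤ (p : ℝ) ^ 4 := by positivity
      split_ifs <;> nlinarith
    calc _ ≤ ∑ l' ∈ A, (p : ℝ) ^ 4 / 2
            * ((if l = l' then 1 else 0) + (if l' = -l then 1 else 0)) :=
          sum_le_sum fun l' _ => h1 l'
      _ ≤ ∑ l', (p : ℝ) ^ 4 / 2 * ((if l = l' then 1 else 0) + (if l' = -l then 1 else 0)) :=
          sum_le_sum_of_subset_of_nonneg (subset_univ _) fun l' _ _ => by positivity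
      _ = (p : ℝ) ^ 4 := by
          rw [← mul_sum, sum_add_distrib]
          simp
          ring
  · have h1 : ∀ ω : Torus p, (∑ l ∈ A, tcos ω l ^ 2) ^ 2 ≤ (A.card : ℝ) ^ 2 := by
      intro ω
      have : ∑ l ∈ A, tcos ω l ^ 2 ≤ A.card := by
        refine (sum_le_card_nsmul _ _ 1 fun l _ => tcos_sq_le_one ω l).trans ?_
        simp
      gcongr
    refine (sum_le_card_nsmul _ _ _ fun ω _ => h1 ω).trans ?_
    simp [sq]

lemma sum_tcos_sq (l : Torus p) :
    (p : ℝ) ^ 2 / 2 ≤ ∑ ω, tcos ω l ^ 2 ∧ ∑ ω, tcos ω l ^ 2 ≤ (p : ℝ) ^ 2 := by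
  have h := sum_tcos_mul_tcos l l
  simp only [← sq] at h
  rw [h, if_pos trivial]
  have : (0 : ℝ) ≤ (p : ℝ) ^ 2 := by positivity
  split_ifs <;> constructor <;> linarith

/-- The cosines attached to the nodes, completed by the Fourier transform of a function `u`. -/
noncomputable def cosFamily (u : Param p) : Option (Torus p) → Torus p → ℝ
  | none => hat u
  | some l => fun ω => tcos ω l

/-- The event on which the fluctuations behave as predicted by their second moments, where `m'` is
a large neighborhood, `M` a small one and `u` an additional direction. -/
def Good (n : ℕ) (m' M : Finset (Torus p)) (u : Param p) (Y : Torus p → ℝ) : Prop :=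
  (n : ℝ) * (p : ℝ) ^ 2 * m'.card / 2 ≤ linSq m' (fun l ω => tcos ω l) Y ∧
  linSq m' (fun l ω => tcos ω l) Y ≤ 5 * ((n : ℝ) * (p : ℝ) ^ 2 * m'.card) / 2 ∧
  quadSq m' (fun l ω => tcos ω l) Y ≤ 16 * ((n : ℝ) * (p : ℝ) ^ 2) * (m'.card : ℝ) ^ 2 ∧
  linSq (insertNone M) (cosFamily u) Y ≤ 16 * ((n : ℝ) * (p : ℝ) ^ 2) * (M.card + 1) ∧
  quadSq (insertNone M) (cosFamily u) Y
    ≤ 16 * ((n : ℝ) * (p : ℝ) ^ 2) * ((M.card + 1) ^ 2 + m'.card)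

lemma half_le_measure_of_integral_le {Ω : Type*} [MeasurableSpace Ω] {μ : Measure Ω}
    [IsProbabilityMeasure μ] {f : Ω → ℝ} (hf : Integrable f μ) (h0 : ∀ x, 0 ≤ f x)
    (h : ∫ x, f x ∂μ ≤ 1 / 2) : (1 / 2 : ENNReal) ≤ μ {x | f x < 1} := by
  have h1 := mul_meas_ge_le_integral_of_nonneg (ae_of_all _ h0) hf 1
  have hms : NullMeasurableSet {x | f x < 1} μ :=
    nullMeasurableSet_lt hf.aestronglyMeasurable.aemeasurable aemeasurable_const
  have h2 := probReal_compl_eq_one_sub₀ hms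
  have h3 : {x | f x < 1}ᶜ = {x | 1 ≤ f x} := by ext; simp
  rw [h3] at h2
  have h4 : 1 / 2 ≤ μ.real {x | f x < 1} := by linarith
  rw [← ENNReal.ofReal_toReal (measure_ne_top μ {x | f x < 1})]
  have h5 : (1 / 2 : ENNReal) = ENNReal.ofReal (1 / 2) := by
    rw [ENNReal.ofReal_div_of_pos (by norm_num)]; simp
  rw [h5]
  exact ENNReal.ofReal_le_ofReal h4

lemma sum_cosFamily_sq_le {k : ℝ} (hk : 1 ≤ k) {M : Finset (Torus p)} {u : Param p}
    (hu : ∑ ω, hat u ω ^ 2 ≤ (p : ℝ) ^ 2) (hu' : ∀ ω, hat u ω ^ 2 ≤ k) :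
    ∑ i ∈ insertNone M, ∑ ω, cosFamily u i ω ^ 2 ≤ (p : ℝ) ^ 2 * (M.card + 1) ∧
    ∑ i ∈ insertNone M, ∑ j ∈ insertNone M, ∑ ω, (cosFamily u i ω * cosFamily u j ω) ^ 2
      ≤ (p : ℝ) ^ 2 * ((M.card + 1) ^ 2 + k) := by
  have h1 : ∀ i, ∑ ω, cosFamily u i ω ^ 2 ≤ (p : ℝ) ^ 2 := by
    rintro (_ | l)
    · exact hu
    · exact (sum_tcos_sq l).2
  have h2 : ∀ i (l : Torus p), ∑ ω, (cosFamily u i ω * tcos ω l) ^ 2 ≤ (p : ℝ) ^ 2 := by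
    intro i l
    refine le_trans (sum_le_sum fun ω _ => ?_) (h1 i)
    rw [mul_pow]
    exact mul_le_of_le_one_right (sq_nonneg _) (tcos_sq_le_one ω l)
  have h2' : ∀ i (l : Torus p), ∑ ω, (tcos ω l * cosFamily u i ω) ^ 2 ≤ (p : ℝ) ^ 2 := by
    intro i l
    simpa only [mul_comm] using h2 i l
  have h3 : ∑ ω, (hat u ω * hat u ω) ^ 2 ≤ k * (p : ℝ) ^ 2 := by
    refine le_trans ?_ (mul_le_mul_of_nonneg_left hu (by linarith))
    rw [mul_sum]
    refine sum_le_sum fun ω _ => ?_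
    rw [mul_pow]
    exact mul_le_mul_of_nonneg_right (hu' ω) (sq_nonneg _)
  have hsum : ∀ g : Torus p → ℝ, (∀ l, g l ≤ (p : ℝ) ^ 2) →
      ∑ l ∈ M, g l ≤ M.card * (p : ℝ) ^ 2 := by
    intro g hg
    refine (sum_le_card_nsmul _ _ _ fun l _ => hg l).trans ?_
    simp
  constructor
  · rw [sum_insertNone]
    have := hsum _ fun l => h1 (some l)
    linarith [h1 none]
  · simp only [sum_insertNone]
    have a1 := hsum _ fun l => h2 none l
    have a2 : ∑ l ∈ M, (∑ ω, (cosFamily u (some l) ω * cosFamily u none ω) ^ 2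
        + ∑ l' ∈ M, ∑ ω, (cosFamily u (some l) ω * cosFamily u (some l') ω) ^ 2)
        ≤ M.card * ((p : ℝ) ^ 2 + M.card * (p : ℝ) ^ 2) := by
      refine (sum_le_card_nsmul _ _ ((p : ℝ) ^ 2 + M.card * (p : ℝ) ^ 2) fun l _ => ?_).trans ?_
      · exact add_le_add (h2' none l) (hsum _ fun l' => h2 (some l) l')
      · rw [nsmul_eq_mul]
    have a3 : (0 : ℝ) ≤ (p : ℝ) ^ 2 := by positivity
    change ∑ ω, (hat u ω * hat u ω) ^ 2 + ∑ l ∈ M, ∑ ω, (cosFamily u none ω * tcos ω l) ^ 2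
      + _ ≤ _
    nlinarith

/-- The fluctuations are under control with probability at least one half. -/
lemma half_le_measure_good {n : ℕ} {m' M : Finset (Torus p)} {u : Param p}
    (hu : ∑ ω, hat u ω ^ 2 ≤ (p : ℝ) ^ 2) (hu' : ∀ ω, hat u ω ^ 2 ≤ m'.card)
    (hk : 512 ≤ (m'.card : ℝ)) (hN : 3072 ≤ (n : ℝ) * (p : ℝ) ^ 2) :
    (1 / 2 : ENNReal) ≤ (Measure.pi fun _ : Fin n × Torus p => gaussianReal 0 1)
      {w | Good n m' M u (fluct w)} := by
  set μ : Measure (Fin n × Torus p → ℝ) := Measure.pi fun _ => gaussianReal 0 1 with hμ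
  set k : ℝ := (m'.card : ℝ) with hk_def
  set N2 : ℝ := (n : ℝ) * (p : ℝ) ^ 2 with hN2
  set c : ℝ := (M.card : ℝ) + 1 with hc
  have hk0 : 0 < k := by linarith
  have hN0 : 0 < N2 := by linarith
  have hc0 : 0 < c := by positivity
  set τ : ℝ := 2 * (n * ∑ l ∈ m', ∑ ω, tcos ω l ^ 2) with hτ
  have hτ1 : N2 * k ≤ τ := by
    have : k * ((p : ℝ) ^ 2 / 2) ≤ ∑ l ∈ m', ∑ ω, tcos ω l ^ 2 := by
      rw [hk_def, ← nsmul_eq_mul]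
      exact card_nsmul_le_sum _ _ _ fun l _ => (sum_tcos_sq l).1
    have := mul_le_mul_of_nonneg_left this (Nat.cast_nonneg (α := ℝ) n)
    rw [hτ, hN2]
    linarith
  have hτ2 : τ ≤ 2 * (N2 * k) := by
    have : ∑ l ∈ m', ∑ ω, tcos ω l ^ 2 ≤ k * (p : ℝ) ^ 2 := by
      rw [hk_def, ← nsmul_eq_mul]
      exact sum_le_card_nsmul _ _ _ fun l _ => (sum_tcos_sq l).2
    have := mul_le_mul_of_nonneg_left this (Nat.cast_nonneg (α := ℝ) n)
    rw [hτ, hN2]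
    linarith
  set ca : ℝ := (N2 * k) ^ 2 / 4 with hca
  set cb : ℝ := 16 * N2 * k ^ 2 with hcb
  set cc : ℝ := 16 * N2 * c with hcc
  set cd : ℝ := 16 * N2 * (c ^ 2 + k) with hcd
  have hca0 : 0 < ca := by positivity
  have hcb0 : 0 < cb := by positivity
  have hcc0 : 0 < cc := by positivity
  have hcd0 : 0 < cd := by positivity
  obtain ⟨ia, ea⟩ := integral_linSq_sub_sq n m' (fun l ω => tcos ω l)
  have ea' := integral_linSq_tcos_sub_sq_le n m'
  clear ea
  rw [← hτ] at ia ea'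
  have ib := integrable_quadSq n m' (fun l ω => tcos ω l)
  have ic := integrable_linSq n (insertNone M) (cosFamily u)
  have id := integrable_quadSq n (insertNone M) (cosFamily u)
  obtain ⟨hC, hD⟩ := sum_cosFamily_sq_le (M := M) (k := k) (by linarith) hu hu'
  have ba : ∫ w, (linSq m' (fun l ω => tcos ω l) (fluct w) - τ) ^ 2 ∂μ ≤ 1 / 8 * ca := by
    refine ea'.trans ?_
    have e : 8 * ((n : ℝ) ^ 2 * (k * (p : ℝ) ^ 4)) + 48 * (n * ((p : ℝ) ^ 2 * k ^ 2))
        = 8 * N2 ^ 2 * k + 48 * N2 * k ^ 2 := by rw [hN2]; ring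
    rw [← hk_def, e, hca]
    have h1 : N2 ^ 2 * k * 512 ≤ N2 ^ 2 * k * k := by gcongr
    have h2 : N2 * k ^ 2 * 3072 ≤ N2 * k ^ 2 * N2 := by gcongr
    linarith
  have bb : ∫ w, quadSq m' (fun l ω => tcos ω l) (fluct w) ∂μ ≤ 1 / 8 * cb := by
    rw [integral_quadSq]
    have : ∑ l ∈ m', ∑ l' ∈ m', ∑ ω : Torus p, (tcos ω l * tcos ω l') ^ 2
        ≤ k * (k * (p : ℝ) ^ 2) := by
      rw [hk_def, ← nsmul_eq_mul, ← nsmul_eq_mul]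
      refine sum_le_card_nsmul _ _ _ fun l _ => sum_le_card_nsmul _ _ _ fun l' _ => ?_
      refine le_trans (sum_le_sum fun ω _ => ?_) (sum_tcos_sq l).2
      rw [mul_pow]
      exact mul_le_of_le_one_right (sq_nonneg _) (tcos_sq_le_one ω l')
    have := mul_le_mul_of_nonneg_left this (Nat.cast_nonneg (α := ℝ) n)
    rw [hcb, hN2]
    linarith
  have bc : ∫ w, linSq (insertNone M) (cosFamily u) (fluct w) ∂μ ≤ 1 / 8 * cc := by
    rw [integral_linSq]
    have := mul_le_mul_of_nonneg_left hC (Nat.cast_nonneg (α := ℝ) n)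
    rw [hcc, hN2]
    linarith
  have bd : ∫ w, quadSq (insertNone M) (cosFamily u) (fluct w) ∂μ ≤ 1 / 8 * cd := by
    rw [integral_quadSq]
    have := mul_le_mul_of_nonneg_left hD (Nat.cast_nonneg (α := ℝ) n)
    rw [hcd, hN2]
    linarith
  -- Markov's inequality for the sum of the four normalized statistics
  have hint : ∀ {f : (Fin n × Torus p → ℝ) → ℝ} {C : ℝ}, 0 < C → ∫ w, f w ∂μ ≤ 1 / 8 * C →
      ∫ w, f w / C ∂μ ≤ 1 / 8 := by
    intro f C hC h
    rw [integral_div, div_le_iff₀ hC]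
    exact h
  have iab := (ia.div_const ca).add (ib.div_const cb)
  have icd := (ic.div_const cc).add (id.div_const cd)
  refine (half_le_measure_of_integral_le (iab.add icd) (fun w => ?_) ?_).trans
    (measure_mono fun w hw => ?_)
  · have h1 := linSq_nonneg (insertNone M) (cosFamily u) (fluct w)
    have h2 := quadSq_nonneg (insertNone M) (cosFamily u) (fluct w)
    have h3 := quadSq_nonneg m' (fun l ω => tcos ω l) (fluct w)
    simp only [Pi.add_apply]
    positivity
  · rw [integral_add' iab icd, integral_add' (ia.div_const ca) (ib.div_const cb),
      integral_add' (ic.div_const cc) (id.div_const cd)]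
    linarith [hint hca0 ba, hint hcb0 bb, hint hcc0 bc, hint hcd0 bd]
  · simp only [Pi.add_apply, Set.mem_ofPred_eq] at hw
    have h1 := div_nonneg (linSq_nonneg (insertNone M) (cosFamily u) (fluct w)) hcc0.le
    have h2 := div_nonneg (quadSq_nonneg (insertNone M) (cosFamily u) (fluct w)) hcd0.le
    have h3 := div_nonneg (quadSq_nonneg m' (fun l ω => tcos ω l) (fluct w)) hcb0.le
    have h4 := div_nonneg (sq_nonneg (linSq m' (fun l ω => tcos ω l) (fluct w) - τ)) hca0.le
    have ha : (linSq m' (fun l ω => tcos ω l) (fluct w) - τ) ^ 2 ≤ (N2 * k / 2) ^ 2 := by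
      have : (linSq m' (fun l ω => tcos ω l) (fluct w) - τ) ^ 2 / ca ≤ 1 := by linarith
      rw [div_le_one hca0] at this
      refine this.trans (le_of_eq ?_)
      rw [hca]; ring
    have ha' := abs_le_of_sq_le_sq' ha (by positivity)
    refine ⟨?_, ?_, ?_, ?_, ?_⟩
    · linarith [ha'.1]
    · linarith [ha'.2]
    · exact (div_le_one hcb0).1 (by linarith)
    · exact (div_le_one hcc0).1 (by linarith)
    · exact (div_le_one hcd0).1 (by linarith)

end Fluctuations

/-! ### The least squares criterion around the true parameter -/

section Criterion

variable {p : ℕ} [NeZero p]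

lemma specCrit_add {n : ℕ} {θ h : Param p} (hθ : ∀ ω, hat θ ω < 1) (h0 : h 0 = 0)
    (Y : Torus p → ℝ) :
    specCrit n θ Y (θ + h) = specCrit n θ Y θ - 2 * ∑ ω, hat h ω * Y ω
      + ∑ ω, hat h ω ^ 2 / (1 - hat θ ω) * (n + Y ω) := by
  have e : ∀ ω, (1 - hat (θ + h) ω) ^ 2 / (1 - hat θ ω) * (n + Y ω)
      = (1 - hat θ ω) ^ 2 / (1 - hat θ ω) * (n + Y ω) - 2 * (hat h ω * Y ω) - 2 * n * hat h ω
        + hat h ω ^ 2 / (1 - hat θ ω) * (n + Y ω) := by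
    intro ω
    have hpos : 1 - hat θ ω ≠ 0 := (sub_pos.2 (hθ ω)).ne'
    rw [hat_add]
    field_simp
    ring
  simp only [specCrit, e, sum_add_distrib, sum_sub_distrib, ← mul_sum, sum_hat, h0]
  ring

lemma sq_sum_abs_le {A : Finset (Torus p)} {h : Param p} (hA : ∀ x, x ∉ A → h x = 0) :
    (∑ l, |h l|) ^ 2 ≤ A.card * ∑ l, h l ^ 2 := by
  have e1 : ∑ l, |h l| = ∑ l ∈ A, |h l| :=
    (sum_subset (subset_univ A) fun l _ hl => by simp [hA l hl]).symm
  have e2 : ∑ l, h l ^ 2 = ∑ l ∈ A, |h l| ^ 2 := by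
    simp only [sq_abs]
    exact (sum_subset (subset_univ A) fun l _ hl => by simp [hA l hl]).symm
  rw [e1, e2]
  exact sq_sum_le_card_mul_sum_sq

lemma hat_eq_sum_of_support {A : Finset (Torus p)} {h : Param p} (hA : ∀ x, x ∉ A → h x = 0)
    (ω : Torus p) : hat h ω = ∑ l ∈ A, h l * tcos ω l :=
  (sum_subset (subset_univ A) fun l _ hl => by simp [hA l hl]).symm

/-- On `Θ⁺_{m,ρ}` the margin `φ_min ∧ (ρ - φ_max)` is positive. -/
lemma margin_pos {ρ : ℝ} {m : Finset (Torus p)} {θ : Param p} (hθ : θ ∈ ThetaPlus ρ m) :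
    0 < phiMin (1 - C θ) ∧ 0 < phiMax (1 - C θ)
      ∧ 0 < min (phiMin (1 - C θ)) (ρ - phiMax (1 - C θ)) := by
  have h := (mem_ThetaPlus_iff.1 hθ).2
  obtain ⟨ω, hω⟩ := exists_phiMin_eq hθ.1.1.2
  obtain ⟨ω', hω'⟩ := exists_phiMax_eq hθ.1.1.2
  have h1 : 0 < phiMin (1 - C θ) := by rw [hω]; exact sub_pos.2 (h ω).1
  have h2 : 0 < phiMax (1 - C θ) := by rw [hω']; exact sub_pos.2 (h ω').1
  have h3 : phiMax (1 - C θ) < ρ := hθ.2.2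
  exact ⟨h1, h2, lt_min h1 (sub_pos.2 h3)⟩

/-- Moving from `θ` in the direction of the empirical autocovariances improves the criterion. The
step is proportional to the margin `φ_min ∧ (ρ - φ_max)`: it stays in `Θ⁺` because its `ℓ¹` norm is
smaller than the margin, which is where `d_{m'} ≤ √(n p²)` is needed. -/
lemma exists_specCrit_le {n : ℕ} {ρ : ℝ} {m' M : Finset (Torus p)} {u : Param p} (hm' : m' ∈ M1 p)
    {θ : Param p} (hθ : θ ∈ ThetaPlus ρ m') {Y : Torus p → ℝ} (hY : ∀ ω, 0 ≤ n + Y ω)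
    (hN : 0 < (n : ℝ) * (p : ℝ) ^ 2) (hk : (m'.card : ℝ) ^ 2 ≤ 4 * ((n : ℝ) * (p : ℝ) ^ 2))
    (hgood : Good n m' M u Y) :
    ∃ θ' ∈ ThetaPlus ρ m', specCrit n θ Y θ' + min (phiMin (1 - C θ)) (ρ - phiMax (1 - C θ))
      * m'.card / 18 ≤ specCrit n θ Y θ := by
  classical
  obtain ⟨ha, -, hδ⟩ := margin_pos hθ
  have hs := hθ.1.1.2
  have hθ' := mem_ThetaPlus_iff.1 hθ
  obtain ⟨hT1, hT2, hF, -, -⟩ := hgood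
  set a := phiMin (1 - C θ) with ha_def
  set δ := min a (ρ - phiMax (1 - C θ)) with hδ_def
  set N2 : ℝ := (n : ℝ) * (p : ℝ) ^ 2 with hN2
  set k : ℝ := (m'.card : ℝ) with hk_def
  set T := linSq m' (fun l ω => tcos ω l) Y with hT
  have hT0 : 0 ≤ T := linSq_nonneg _ _ _
  have hk0 : 0 ≤ k := by positivity
  set S : Torus p → ℝ := fun l => ∑ ω, tcos ω l * Y ω with hS
  set h : Param p := fun l => if l ∈ m' then δ / (9 * N2) * S l else 0 with hh
  have hsupp : ∀ x, x ∉ m' → h x = 0 := fun x hx => by simp [hh, hx]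
  have hin : ∀ x ∈ m', h x = δ / (9 * N2) * S x := fun x hx => by simp [hh, hx]
  have h0 : h 0 = 0 := hsupp 0 (zero_notMem_of_mem_M1 hm')
  have hsym : ∀ x, h (-x) = h x := by
    intro x
    have hmem : -x ∈ m' ↔ x ∈ m' :=
      ⟨fun hx => by simpa using neg_mem_of_mem_M1 hm' hx, neg_mem_of_mem_M1 hm'⟩
    simp only [hh, hmem, hS, tcos_neg]
  have hsq : ∑ l, h l ^ 2 = (δ / (9 * N2)) ^ 2 * T := by
    rw [← sum_subset (subset_univ m') fun l _ hl => by simp [hsupp l hl], hT, linSq, mul_sum]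
    exact sum_congr rfl fun l hl => by rw [hin l hl, mul_pow]
  have hlin : ∑ ω, hat h ω * Y ω = δ / (9 * N2) * T := by
    simp only [hat_eq_sum_of_support hsupp, sum_mul]
    rw [sum_comm, hT, linSq, mul_sum]
    refine sum_congr rfl fun l hl => ?_
    simp only [mul_assoc, ← mul_sum]
    rw [hin l hl]
    simp only [hS]
    ring
  have hq : |∑ ω, hat h ω ^ 2 * Y ω| ≤ 8 * N2 * ∑ l, h l ^ 2 := by
    have h1 := sq_sum_sq_mul_le_quadSq m' (fun l ω => tcos ω l) Y h
    simp only [← hat_eq_sum_of_support hsupp] at h1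
    rw [sum_subset (subset_univ m') fun l _ hl => by simp [hsupp l hl]] at h1
    have hq0 : 0 ≤ ∑ l, h l ^ 2 := sum_nonneg fun _ _ => sq_nonneg _
    refine abs_le_of_sq_le_sq ?_ (by positivity)
    refine h1.trans ?_
    have h2 : quadSq m' (fun l ω => tcos ω l) Y ≤ 64 * N2 ^ 2 :=
      hF.trans (by nlinarith)
    calc _ ≤ (∑ l, h l ^ 2) ^ 2 * (64 * N2 ^ 2) := by gcongr
      _ = _ := by ring
  have hquad : ∑ ω, hat h ω ^ 2 / (1 - hat θ ω) * (n + Y ω) ≤ 9 * N2 * (∑ l, h l ^ 2) / a := by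
    calc _ ≤ ∑ ω, hat h ω ^ 2 / a * (n + Y ω) := by
          refine sum_le_sum fun ω _ => ?_
          have := phiMin_le_one_sub_hat hs ω
          have := hY ω
          gcongr
      _ = (n * ∑ ω, hat h ω ^ 2 + ∑ ω, hat h ω ^ 2 * Y ω) / a := by
          rw [mul_sum, ← sum_add_distrib, sum_div]
          exact sum_congr rfl fun ω _ => by ring
      _ ≤ _ := by
          rw [sum_hat_sq hsym]
          gcongr
          rw [hN2] at hq ⊢
          linarith [(abs_le.1 hq).2]
  -- Cauchy-Schwarz: the `ℓ¹` norm is at most `√k` times the `ℓ²` norm, and `k ≤ 2 √N2`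
  have hl1 : ∑ l, |h l| < δ := by
    have h1 := sq_sum_abs_le hsupp
    rw [hsq, ← hk_def] at h1
    have h2 : k * ((δ / (9 * N2)) ^ 2 * T) ≤ 10 / 81 * δ ^ 2 := by
      calc _ ≤ k * ((δ / (9 * N2)) ^ 2 * (5 * (N2 * k) / 2)) := by gcongr
        _ = 5 / 162 * δ ^ 2 / N2 * k ^ 2 := by field_simp; ring
        _ ≤ 5 / 162 * δ ^ 2 / N2 * (4 * N2) := by gcongr
        _ = _ := by field_simp; ring
    refine lt_of_pow_lt_pow_left₀ 2 hδ.le (h1.trans_lt (h2.trans_lt ?_))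
    nlinarith [pow_pos hδ 2]
  refine ⟨θ + h, mem_ThetaPlus_iff.2 ⟨(ThetaM m').add_mem hθ.1 ⟨⟨h0, hsym⟩, hsupp⟩,
    fun ω => ?_⟩, ?_⟩
  · have h1 := abs_lt.1 ((abs_hat_le h ω).trans_lt hl1)
    have h2 := phiMin_le_one_sub_hat hs ω
    have h3 := one_sub_hat_le_phiMax hs ω
    have h4 : δ ≤ a := min_le_left _ _
    have h5 : δ ≤ ρ - phiMax (1 - C θ) := min_le_right _ _
    rw [hat_add]
    constructor <;> linarith [h1.1, h1.2]
  · rw [specCrit_add (fun ω => (hθ'.2 ω).1) h0, hlin]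
    have h1 : 9 * N2 * (∑ l, h l ^ 2) / a ≤ δ / (9 * N2) * T := by
      rw [hsq, div_le_iff₀ ha]
      have h4 : δ ≤ a := min_le_left _ _
      calc 9 * N2 * ((δ / (9 * N2)) ^ 2 * T) = δ / (9 * N2) * T * δ := by field_simp
        _ ≤ _ := by gcongr
    have h2 : δ * k / 18 ≤ δ / (9 * N2) * T := by
      calc δ * k / 18 = δ / (9 * N2) * (N2 * k / 2) := by field_simp; ring
        _ ≤ _ := by gcongr
    linarith

/-- The part of `θ` that the neighborhood `M` does not see. -/
noncomputable def outside (M : Finset (Torus p)) (θ : Param p) : Param p := fun l =>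
  open Classical in if l ∈ M then 0 else θ l

/-- The normalization of `outside M θ`, equal to `0` if `θ` is supported in `M`. -/
noncomputable def outsideDir (M : Finset (Torus p)) (θ : Param p) : Param p := fun l =>
  outside M θ l / √(∑ x, outside M θ x ^ 2)

lemma sqrt_mul_outsideDir (M : Finset (Torus p)) (θ : Param p) (l : Torus p) :
    √(∑ x, outside M θ x ^ 2) * outsideDir M θ l = outside M θ l := by
  have hnn : 0 ≤ ∑ x, outside M θ x ^ 2 := sum_nonneg fun _ _ => sq_nonneg _
  rcases eq_or_ne (√(∑ x, outside M θ x ^ 2)) 0 with h | h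
  · have h1 := (Real.sqrt_eq_zero hnn).1 h
    have h2 := (sum_eq_zero_iff_of_nonneg fun x _ => sq_nonneg (outside M θ x)).1 h1 l (mem_univ l)
    rw [h, zero_mul]
    exact (pow_eq_zero_iff two_ne_zero).1 h2 |>.symm
  · rw [outsideDir]
    field_simp

lemma sum_outsideDir_sq_le (M : Finset (Torus p)) (θ : Param p) :
    ∑ l, outsideDir M θ l ^ 2 ≤ 1 := by
  have hnn : 0 ≤ ∑ x, outside M θ x ^ 2 := sum_nonneg fun _ _ => sq_nonneg _
  simp only [outsideDir, div_pow, ← sum_div, Real.sq_sqrt hnn]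
  exact div_self_le_one _

lemma outsideDir_neg {M : Finset (Torus p)} (hM : M ∈ M1 p) {θ : Param p}
    (hs : ∀ x, θ (-x) = θ x) (x : Torus p) : outsideDir M θ (-x) = outsideDir M θ x := by
  have hmem : -x ∈ M ↔ x ∈ M :=
    ⟨fun hx => by simpa using neg_mem_of_mem_M1 hM hx, neg_mem_of_mem_M1 hM⟩
  simp only [outsideDir, outside, hmem, hs]

/-- A lower bound of the criterion over `Θ_M`, with a linear fluctuation term `e` and a quadratic
term that does not degenerate. -/
lemma specCrit_ge_of_mem_ThetaM {n : ℕ} {ρ : ℝ} {m' M : Finset (Torus p)} {θ : Param p}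
    (hθ : θ ∈ ThetaPlus ρ m') {Y : Torus p → ℝ} (hY : ∀ ω, 0 ≤ n + Y ω)
    (hM : ((M.card : ℝ) + 1) ^ 2 + m'.card ≤ (n : ℝ) * (p : ℝ) ^ 2 / 64)
    (hgood : Good n m' M (outsideDir M θ) Y) {θ' : Param p} (hθ' : θ' ∈ ThetaM M) :
    ∃ e : ℝ, e ^ 2 ≤ 16 * ((n : ℝ) * (p : ℝ) ^ 2) * (M.card + 1) * ∑ l, (θ' l - θ l) ^ 2 ∧
      specCrit n θ Y θ - 2 * e + (n : ℝ) * (p : ℝ) ^ 2 * (∑ l, (θ' l - θ l) ^ 2)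
        / (2 * phiMax (1 - C θ)) ≤ specCrit n θ Y θ' := by
  classical
  obtain ⟨-, hb, -⟩ := margin_pos hθ
  have hs := hθ.1.1.2
  have hθ1 := mem_ThetaPlus_iff.1 hθ
  obtain ⟨-, -, -, hT2, hF2⟩ := hgood
  set b := phiMax (1 - C θ) with hb_def
  set N2 : ℝ := (n : ℝ) * (p : ℝ) ^ 2 with hN2
  have hN0 : 0 ≤ N2 := by positivity
  set f := cosFamily (outsideDir M θ) with hf
  set r := √(∑ x, outside M θ x ^ 2) with hr
  have hnn : 0 ≤ ∑ x, outside M θ x ^ 2 := sum_nonneg fun _ _ => sq_nonneg _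
  set h : Param p := θ' - θ with hh
  have hsym : ∀ x, h (-x) = h x := fun x => by simp [hh, hs, hθ'.1.2 x]
  have h0 : h 0 = 0 := by simp [hh, hθ'.1.1, hθ.1.1.1]
  have hout : ∀ l, l ∉ M → h l = -outside M θ l := fun l hl => by
    simp [hh, outside, hl, hθ'.2 l hl]
  have hins : ∀ l ∈ M, outside M θ l = 0 := fun l hl => by simp [outside, hl]
  -- the coordinates of `θ' - θ`: its values on `M`, and minus the norm of the hidden part of `θ`
  set c : Option (Torus p) → ℝ := fun i => i.elim (-r) h with hc
  have hhat : ∀ ω, hat h ω = ∑ i ∈ insertNone M, c i * f i ω := by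
    intro ω
    rw [sum_insertNone]
    have e1 : c none * f none ω = -∑ l, outside M θ l * tcos ω l := by
      simp only [hc, hf, cosFamily, Option.elim, hat, mul_sum, neg_mul, sum_neg_distrib]
      congr 1
      exact sum_congr rfl fun l _ => by rw [← mul_assoc, sqrt_mul_outsideDir]
    have e2 : ∑ l, outside M θ l * tcos ω l = ∑ l ∈ univ \ M, outside M θ l * tcos ω l := by
      refine (sum_subset (subset_univ _) fun l _ hl => ?_).symm
      rw [hins l (by simpa using hl), zero_mul]
    rw [e1, e2, hat, ← sum_sdiff (subset_univ M), ← sum_neg_distrib]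
    refine congrArg₂ (· + ·) (sum_congr rfl fun l hl => ?_) rfl
    rw [hout l (by simpa using hl), neg_mul]
  have hc2 : ∑ i ∈ insertNone M, c i ^ 2 = ∑ l, h l ^ 2 := by
    rw [sum_insertNone]
    have e1 : c none ^ 2 = ∑ l ∈ univ \ M, outside M θ l ^ 2 := by
      simp only [hc, Option.elim, neg_sq, hr, Real.sq_sqrt hnn]
      refine (sum_subset (subset_univ _) fun l _ hl => ?_).symm
      rw [hins l (by simpa using hl)]
      simp
    rw [e1, ← sum_sdiff (subset_univ M)]
    refine congrArg₂ (· + ·) (sum_congr rfl fun l hl => ?_) rfl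
    rw [hout l (by simpa using hl), neg_sq]
  have hq0 : 0 ≤ ∑ l, h l ^ 2 := sum_nonneg fun _ _ => sq_nonneg _
  have hlin := sq_sum_mul_le_linSq (insertNone M) f Y c
  have hquad := sq_sum_sq_mul_le_quadSq (insertNone M) f Y c
  simp only [← hhat, hc2] at hlin hquad
  have hq : |∑ ω, hat h ω ^ 2 * Y ω| ≤ N2 / 2 * ∑ l, h l ^ 2 := by
    refine abs_le_of_sq_le_sq (hquad.trans ?_) (by positivity)
    have h2 : quadSq (insertNone M) f Y ≤ N2 ^ 2 / 4 := hF2.trans (by nlinarith)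
    calc _ ≤ (∑ l, h l ^ 2) ^ 2 * (N2 ^ 2 / 4) := by gcongr
      _ = _ := by ring
  refine ⟨∑ ω, hat h ω * Y ω, ?_, ?_⟩
  · refine hlin.trans ?_
    rw [mul_comm]
    exact mul_le_mul_of_nonneg_right hT2 hq0
  · have e : θ' = θ + h := by rw [hh]; abel
    have hle : N2 * (∑ l, h l ^ 2) / (2 * b) ≤ ∑ ω, hat h ω ^ 2 / (1 - hat θ ω) * (n + Y ω) := by
      calc N2 * (∑ l, h l ^ 2) / (2 * b)
          ≤ (n * ∑ ω, hat h ω ^ 2 + ∑ ω, hat h ω ^ 2 * Y ω) / b := by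
            rw [sum_hat_sq hsym, div_le_div_iff₀ (by positivity) hb]
            have : N2 / 2 * (∑ l, h l ^ 2)
                ≤ n * ((p : ℝ) ^ 2 * ∑ l, h l ^ 2) + ∑ ω, hat h ω ^ 2 * Y ω := by
              rw [hN2] at hq ⊢
              linarith [(abs_le.1 hq).1]
            nlinarith
        _ = ∑ ω, hat h ω ^ 2 / b * (n + Y ω) := by
            rw [mul_sum, ← sum_add_distrib, sum_div]
            exact sum_congr rfl fun ω _ => by ring
        _ ≤ _ := by
            refine sum_le_sum fun ω _ => ?_
            have h1 := one_sub_hat_le_phiMax hs ω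
            have h2 := hY ω
            have h3 : 0 < 1 - hat θ ω := sub_pos.2 (hθ1.2 ω).1
            gcongr
    have e2 : specCrit n θ Y θ' = specCrit n θ Y (θ + h) := by rw [← e]
    rw [e2, specCrit_add (fun ω => (hθ1.2 ω).1) h0]
    have e3 : ∑ l, (θ' l - θ l) ^ 2 = ∑ l, h l ^ 2 := rfl
    rw [e3]
    linarith

/-- Over a small model, the criterion cannot fall below its value at `θ` by more than half of what
the large model gains. The empty model is treated apart: there, either `θ` is small in `ℓ¹` norm
and the margin is at least `1 / 2`, or the bias exceeds the fluctuations. -/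
lemma specCrit_sub_le_of_mem_ThetaM {n : ℕ} {ρ : ℝ} (hρ : 2 < ρ) {m' M : Finset (Torus p)}
    {θ : Param p}
    (hθ : θ ∈ ThetaPlus ρ m') {Y : Torus p → ℝ} (hY : ∀ ω, 0 ≤ n + Y ω)
    (hk0 : 9216 ≤ (m'.card : ℝ))
    (hk : (m'.card : ℝ) ^ 2 ≤ 4 * ((n : ℝ) * (p : ℝ) ^ 2))
    (hM : ((M.card : ℝ) + 1) ^ 2 + m'.card ≤ (n : ℝ) * (p : ℝ) ^ 2 / 64)
    (hMk : M.Nonempty → 32 * phiMax (1 - C θ) * (M.card + 1)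
      ≤ min (phiMin (1 - C θ)) (ρ - phiMax (1 - C θ)) * m'.card / 36)
    (hgood : Good n m' M (outsideDir M θ) Y) {θ' : Param p} (hθ' : θ' ∈ ThetaM M) :
    specCrit n θ Y θ - min (phiMin (1 - C θ)) (ρ - phiMax (1 - C θ)) * m'.card / 36
      ≤ specCrit n θ Y θ' := by
  obtain ⟨e, he, hle⟩ := specCrit_ge_of_mem_ThetaM hθ hY hM hgood hθ'
  obtain ⟨-, hb, hδ⟩ := margin_pos hθ
  have hs := hθ.1.1.2
  set b := phiMax (1 - C θ) with hb_def
  set δ := min (phiMin (1 - C θ)) (ρ - b) with hδ_def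
  set N2 : ℝ := (n : ℝ) * (p : ℝ) ^ 2 with hN2
  set k : ℝ := (m'.card : ℝ) with hk_def
  set q : ℝ := ∑ l, (θ' l - θ l) ^ 2 with hq
  have hq0 : 0 ≤ q := sum_nonneg fun _ _ => sq_nonneg _
  have hN0 : 0 ≤ N2 := by positivity
  -- the fluctuation term against the quadratic term
  have hamgm : 2 * e ≤ N2 * q / (2 * b) + 32 * b * (M.card + 1) := by
    refine (abs_le_of_sq_le_sq' ?_ (by positivity)).2
    have h1 : N2 * q / (2 * b) * (32 * b * (M.card + 1)) = 16 * N2 * (M.card + 1) * q := by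
      field_simp
      ring
    nlinarith [sq_nonneg (N2 * q / (2 * b) - 32 * b * (M.card + 1))]
  rcases M.eq_empty_or_nonempty with rfl | hne
  · simp only [card_empty, Nat.cast_zero, zero_add, mul_one] at he hamgm
    rcases le_or_gt (∑ l, |θ l|) (1 / 2) with hsmall | hlarge
    · have h1 : b ≤ 3 / 2 := by
        obtain ⟨ω, hω⟩ := exists_phiMax_eq hs
        have := (abs_le.1 ((abs_hat_le θ ω).trans hsmall)).1
        rw [hb_def, hω]; linarith
      have h2 : 1 / 2 ≤ δ := by
        obtain ⟨ω, hω⟩ := exists_phiMin_eq hs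
        have := (abs_le.1 ((abs_hat_le θ ω).trans hsmall)).2
        refine le_min ?_ (by linarith)
        rw [hω]; linarith
      nlinarith
    · have hz : ∀ l, θ' l = 0 := fun l => hθ'.2 l (by simp)
      have hqθ : q = ∑ l, θ l ^ 2 := by simp [hq, hz]
      have h1 : b ≤ 3 * ∑ l, |θ l| := by
        obtain ⟨ω, hω⟩ := exists_phiMax_eq hs
        have := (abs_le.1 (abs_hat_le θ ω)).1
        rw [hb_def, hω]; linarith
      have h2 : (∑ l, |θ l|) ^ 2 ≤ k * q := by
        rw [hqθ]; exact sq_sum_abs_le hθ.1.2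
      have h3 : b ^ 2 ≤ 9 * (k * q) := by
        have := pow_le_pow_left₀ hb.le h1 2
        linarith [mul_pow (3 : ℝ) (∑ l, |θ l|) 2]
      have h4 : 2304 * k ≤ N2 := by nlinarith
      have h5 : 256 * b ^ 2 ≤ N2 * q := by nlinarith
      have h6 : 2 * e ≤ N2 * q / (2 * b) := by
        refine (abs_le_of_sq_le_sq' ?_ (by positivity)).2
        rw [div_pow, le_div_iff₀ (by positivity)]
        have h7 : 0 ≤ N2 * q := by positivity
        nlinarith [sq_nonneg b, mul_le_mul_of_nonneg_left h5 h7,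
          mul_le_mul_of_nonneg_right he (sq_nonneg b)]
      have h7 : 0 ≤ δ * k / 36 := by positivity
      linarith
  · linarith [hMk hne]

end Criterion

/-! ### The lower bound on the dimension of the selected model -/

lemma ThetaM_mono {p : ℕ} {m₁ m₂ : Finset (Torus p)} (h : m₁ ⊆ m₂) {θ : Param p}
    (hθ : θ ∈ ThetaM m₁) : θ ∈ ThetaM m₂ :=
  ⟨hθ.1, fun x hx => hθ.2 x fun hx' => hx (h hx')⟩

lemma fluct_add_nonneg {n p : ℕ} (w : Fin n × Torus p → ℝ) (ω : Torus p) :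
    0 ≤ n + fluct w ω := by
  have : (n : ℝ) + fluct w ω = ∑ k, w (k, ω) ^ 2 := by simp [fluct]
  rw [this]
  exact sum_nonneg fun _ _ => sq_nonneg _

/-- The fraction of `√(n p²) ∧ p²` that the dimension of the selected model exceeds, as a function
of `ρ`, `a = φ_min` and `b = φ_max`. The bound `1 / 100` makes `M` small compared to
`√(n p²)`; the second bound makes the loss `32 φ_max (|M| + 1)` at most half of the gain. The value
outside of the range of these quantities is irrelevant. -/
noncomputable def dimFraction (ρ a b : ℝ) : ℝ :=
  open Classical in
  if 0 < min a (ρ - b) ∧ 0 < b then min (1 / 100) (min a (ρ - b) / (1200000 * b)) else 1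

lemma dimFraction_pos (ρ a b : ℝ) : 0 < dimFraction ρ a b := by
  unfold dimFraction
  split_ifs with h
  · have := h.1
    have := h.2
    positivity
  · norm_num

/-- On the event `Good`, every model with a dimension below the threshold has a criterion that
exceeds the one of `m'` by more than the penalties can compensate. -/
lemma dim_gt_of_good {p n : ℕ} [NeZero p] {ρ : ℝ} (hρ : 2 < ρ) {m' M : Finset (Torus p)}
    (hm' : m' ∈ M1 p) {σ : ℝ} (hσ : 0 < σ) {θ : Param p} (hθ : θ ∈ ThetaPlus ρ m')
    (hN : 0 < (n : ℝ) * (p : ℝ) ^ 2)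
    (hk0 : 9216 ≤ (m'.card : ℝ)) (hk : (m'.card : ℝ) ^ 2 ≤ 4 * ((n : ℝ) * (p : ℝ) ^ 2))
    {t : ℝ} (hMt : ∀ m ∈ M1 p, (dim m : ℝ) ≤ t → m ⊆ M)
    (hM : ((M.card : ℝ) + 1) ^ 2 + m'.card ≤ (n : ℝ) * (p : ℝ) ^ 2 / 64)
    (hMk : M.Nonempty → 32 * phiMax (1 - C θ) * (M.card + 1)
      ≤ min (phiMin (1 - C θ)) (ρ - phiMax (1 - C θ)) * m'.card / 36)
    {η : ℝ} (hη0 : 0 < η) (hη1 : η < 1) {pen : Finset (Torus p) → ℝ}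
    (hpen : ∀ m ∈ M1 p, pen m' - pen m ≤ 1 / 72 * (1 - η) * σ ^ 2
      * min (phiMin (1 - C θ)) (ρ - phiMax (1 - C θ))
      * (((dim m' : ℝ) - (dim m : ℝ)) / ((n : ℝ) * (p : ℝ) ^ 2)))
    {θhat : Finset (Torus p) → Sample n p → Param p} {mhat : Sample n p → Finset (Torus p)}
    (hest : IsCLSEstimator ρ θhat) (hsel : IsSelectedModel pen θhat mhat)
    {w : Fin n × Torus p → ℝ} (hgood : Good n m' M (outsideDir M θ) (fluct w)) :
    t < dim (mhat fun k => fieldOf σ θ fun ω => w (k, ω)) := by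
  set X : Sample n p := fun k => fieldOf σ θ fun ω => w (k, ω) with hX
  obtain ⟨ha, hb, hδ⟩ := margin_pos hθ
  have hθ1 : ∀ ω, hat θ ω < 1 := fun ω => ((mem_ThetaPlus_iff.1 hθ).2 ω).1
  have hY := fluct_add_nonneg w
  set δ := min (phiMin (1 - C θ)) (ρ - phiMax (1 - C θ)) with hδ_def
  set N2 : ℝ := (n : ℝ) * (p : ℝ) ^ 2 with hN2
  by_contra! hcon
  obtain ⟨hmem, hmin⟩ := hsel X
  have h1 := hmin m' hm'
  obtain ⟨θ'', hθ'', hgain⟩ := exists_specCrit_le hm' hθ hY hN hk hgood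
  have h2 := (hest m' hm' X).2 θ'' (subset_closure hθ'')
  have hsub := hMt _ hmem hcon
  have h3 : θhat (mhat X) X ∈ ThetaM (mhat X) := closure_ThetaPlus_subset (hest _ hmem X).1
  have hloss := specCrit_sub_le_of_mem_ThetaM hρ hθ hY hk0 hk hM hMk hgood (ThetaM_mono hsub h3)
  have h4 := hpen _ hmem
  rw [gammaCLS_eq hθ1 hθ''.1.1] at h2
  rw [gammaCLS_eq hθ1 h3.1] at h1
  rw [← hδ_def] at hgain hloss
  have hdk : (dim m' : ℝ) ≤ m'.card := by exact_mod_cast dim_le_card m'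
  have hs : 0 < σ ^ 2 / N2 := by positivity
  have h5 : σ ^ 2 / N2 * (δ * m'.card / 36) ≤ σ ^ 2 / N2 * specCrit n θ (fluct w) (θhat (mhat X) X)
      - σ ^ 2 / N2 * specCrit n θ (fluct w) θ'' := by
    rw [← mul_sub]
    exact mul_le_mul_of_nonneg_left (by linarith) hs.le
  have h6 : 1 / 72 * (1 - η) * σ ^ 2 * δ * (((dim m' : ℝ) - (dim (mhat X) : ℝ)) / N2)
      ≤ σ ^ 2 / N2 * (δ * m'.card / 72) := by
    have e : 1 / 72 * (1 - η) * σ ^ 2 * δ * (((dim m' : ℝ) - (dim (mhat X) : ℝ)) / N2)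
        = σ ^ 2 / N2 * (δ * ((1 - η) * ((dim m' : ℝ) - (dim (mhat X) : ℝ))) / 72) := by ring
    rw [e]
    have h7 : (0 : ℝ) ≤ dim (mhat X) := by positivity
    have h8 : (1 - η) * ((dim m' : ℝ) - (dim (mhat X) : ℝ)) ≤ m'.card := by nlinarith
    gcongr
  have h9 : 0 < σ ^ 2 / N2 * (δ * m'.card / 72) := by positivity
  have h10 : σ ^ 2 / N2 * (δ * m'.card / 36) = 2 * (σ ^ 2 / N2 * (δ * m'.card / 72)) := by ring
  linarith

end GMRF

theorem proposition4p1 :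
    ∃ (p₀ : ℕ) (K₁ : ℝ) (L : ℝ → ℝ → ℝ → ℝ → ℝ),
      0 < K₁ ∧ (∀ η ρ a b : ℝ, 0 < L η ρ a b) ∧
      ∀ (ρ η : ℝ), 2 < ρ → 0 < η → η < 1 →
      ∀ (p n : ℕ) [NeZero p], p₀ < p → 0 < n →
      ∀ (m' : Finset (GMRF.Torus p)), GMRF.IsLargestModel n m' →
      ∀ (σ : ℝ), 0 < σ →
      ∀ θ ∈ GMRF.ThetaPlus ρ m',
      ∀ (pen : Finset (GMRF.Torus p) → ℝ), (∀ m ∈ GMRF.M1 p, 0 ≤ pen m) →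
        (∀ m ∈ GMRF.M1 p,
          pen m' - pen m ≤
            K₁ * (1 - η) * σ ^ 2
              * min (GMRF.phiMin (1 - GMRF.C θ)) (ρ - GMRF.phiMax (1 - GMRF.C θ))
              * (((GMRF.dim m' : ℝ) - (GMRF.dim m : ℝ)) / ((n : ℝ) * (p : ℝ) ^ 2))) →
      ∀ (θhat : Finset (GMRF.Torus p) → GMRF.Sample n p → GMRF.Param p)
        (mhat : GMRF.Sample n p → Finset (GMRF.Torus p)),
        GMRF.IsCLSEstimator ρ θhat → GMRF.IsSelectedModel pen θhat mhat →
        (1 / 2 : ENNReal) ≤ GMRF.sampleLaw n σ θ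
          {X | L η ρ (GMRF.phiMin (1 - GMRF.C θ)) (GMRF.phiMax (1 - GMRF.C θ))
                * min √((n : ℝ) * (p : ℝ) ^ 2) ((p : ℝ) ^ 2)
              < (GMRF.dim (mhat X) : ℝ)} := by
  open GMRF in
  refine ⟨10 ^ 7, 1 / 72, fun _ ρ a b => dimFraction ρ a b, by norm_num,
    fun _ ρ a b => dimFraction_pos ρ a b, ?_⟩
  intro ρ η hρ hη0 hη1 p n _ hp hn m' hm' σ hσ θ hθ pen _ hpen θhat mhat hest hsel
  obtain ⟨⟨hm'1, hm'dim⟩, hm'max⟩ := hm'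
  obtain ⟨ha, hb, hδ⟩ := margin_pos hθ
  have hθ1 : ∀ ω, hat θ ω < 1 := fun ω => ((mem_ThetaPlus_iff.1 hθ).2 ω).1
  have hL0 := dimFraction_pos ρ (phiMin (1 - C θ)) (phiMax (1 - C θ))
  have hL1 : dimFraction ρ (phiMin (1 - C θ)) (phiMax (1 - C θ)) ≤ 1 / 100 := by
    rw [dimFraction, if_pos ⟨hδ, hb⟩]
    exact min_le_left _ _
  have hL2 : dimFraction ρ (phiMin (1 - C θ)) (phiMax (1 - C θ))
      ≤ min (phiMin (1 - C θ)) (ρ - phiMax (1 - C θ)) / (1200000 * phiMax (1 - C θ)) := by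
    rw [dimFraction, if_pos ⟨hδ, hb⟩]
    exact min_le_right _ _
  set L := dimFraction ρ (phiMin (1 - C θ)) (phiMax (1 - C θ)) with hL
  set N : ℝ := √((n : ℝ) * (p : ℝ) ^ 2) with hN
  have hN2 : N ^ 2 = (n : ℝ) * (p : ℝ) ^ 2 := Real.sq_sqrt (by positivity)
  have hp' : (10 : ℝ) ^ 7 < p := by exact_mod_cast hp
  have hn' : (1 : ℝ) ≤ n := by exact_mod_cast hn
  have hNp : (p : ℝ) ≤ N := Real.le_sqrt_of_sq_le (by nlinarith [sq_nonneg (p : ℝ)])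
  set t₀ : ℝ := min N ((p : ℝ) ^ 2) with ht₀
  have ht₀p : (p : ℝ) ≤ t₀ := le_min hNp (by nlinarith)
  have ht₀k : t₀ ≤ 256 * (m'.card : ℝ) :=
    min_le_mul_card_of_greatest (by omega) (by linarith) fun m hm hdm => hm'max ⟨hm, hdm⟩
  -- `p > 10 ^ 7` is only used to make `k` and `N` larger than absolute constants
  have hk0 : 9216 ≤ (m'.card : ℝ) := by linarith
  have hkN : (m'.card : ℝ) ≤ 2 * N := by
    have h1 : (m'.card : ℝ) ≤ 2 * dim m' := by
      exact_mod_cast card_le_two_mul_dim (zero_notMem_of_mem_M1 hm'1)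
        fun x hx => neg_mem_of_mem_M1 hm'1 hx
    linarith
  have hk : (m'.card : ℝ) ^ 2 ≤ 4 * ((n : ℝ) * (p : ℝ) ^ 2) := by
    rw [← hN2]
    nlinarith
  have hLt0 : 0 ≤ L * t₀ := mul_nonneg hL0.le (by linarith)
  obtain ⟨M, hM1, hMdim, hMmax⟩ := exists_greatest_model (p := p) hLt0
  have hMcard : (M.card : ℝ) ≤ 2 * (L * t₀) := by
    have h1 : (M.card : ℝ) ≤ 2 * dim M := by
      exact_mod_cast card_le_two_mul_dim (zero_notMem_of_mem_M1 hM1)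
        fun x hx => neg_mem_of_mem_M1 hM1 hx
    linarith
  have hM : ((M.card : ℝ) + 1) ^ 2 + m'.card ≤ (n : ℝ) * (p : ℝ) ^ 2 / 64 := by
    have h1 : L * t₀ ≤ 1 / 100 * N :=
      mul_le_mul hL1 (min_le_left _ _) (by linarith) (by norm_num)
    have h2 : (M.card : ℝ) + 1 ≤ N / 12 := by linarith
    have h3 : ((M.card : ℝ) + 1) ^ 2 ≤ (N / 12) ^ 2 := by gcongr
    rw [← hN2]
    nlinarith
  have hMk : M.Nonempty → 32 * phiMax (1 - C θ) * (M.card + 1)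
      ≤ min (phiMin (1 - C θ)) (ρ - phiMax (1 - C θ)) * m'.card / 36 := by
    intro hne
    have h1 : (1 : ℝ) ≤ M.card := by exact_mod_cast hne.card_pos
    have h2 : L * t₀ ≤ L * (256 * (m'.card : ℝ)) := by gcongr
    -- `|M| + 1 ≤ 2 |M|`, which fails for the empty model
    have h3 : (M.card : ℝ) + 1 ≤ 1024 * L * m'.card := by linarith
    rw [le_div_iff₀ (by positivity)] at hL2
    calc 32 * phiMax (1 - C θ) * (M.card + 1)
        ≤ 32 * phiMax (1 - C θ) * (1024 * L * m'.card) := by gcongr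
      _ = L * (1200000 * phiMax (1 - C θ)) * m'.card * (32768 / 1200000) := by ring
      _ ≤ min (phiMin (1 - C θ)) (ρ - phiMax (1 - C θ)) * m'.card * (32768 / 1200000) := by gcongr
      _ ≤ _ := by
        have : 0 ≤ min (phiMin (1 - C θ)) (ρ - phiMax (1 - C θ)) * (m'.card : ℝ) := by positivity
        linarith
  have hu2 := sum_outsideDir_sq_le M θ
  have hu : ∑ ω, hat (outsideDir M θ) ω ^ 2 ≤ (p : ℝ) ^ 2 := by
    rw [sum_hat_sq (outsideDir_neg hM1 hθ.1.1.2)]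
    exact mul_le_of_le_one_right (by positivity) hu2
  have hu' : ∀ ω, hat (outsideDir M θ) ω ^ 2 ≤ m'.card := by
    intro ω
    have hsupp : ∀ x, x ∉ m' → outsideDir M θ x = 0 := fun x hx => by
      simp [outsideDir, outside, hθ.1.2 x hx]
    calc hat (outsideDir M θ) ω ^ 2 = |hat (outsideDir M θ) ω| ^ 2 := (sq_abs _).symm
      _ ≤ (∑ l, |outsideDir M θ l|) ^ 2 := by gcongr; exact abs_hat_le (outsideDir M θ) ω
      _ ≤ m'.card * ∑ l, outsideDir M θ l ^ 2 := sq_sum_abs_le hsupp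
      _ ≤ m'.card := mul_le_of_le_one_right (by positivity) hu2
  have hN3072 : 3072 ≤ (n : ℝ) * (p : ℝ) ^ 2 := by rw [← hN2]; nlinarith
  have hmeas : Measurable fun (w : Fin n × Torus p → ℝ) (k : Fin n) =>
      fieldOf σ θ fun ω => w (k, ω) :=
    measurable_pi_lambda _ fun k => (measurable_fieldOf σ θ).comp
      (measurable_pi_lambda _ fun ω => measurable_pi_apply (k, ω))
  rw [sampleLaw_eq_map n hσ hθ.1.1.2 hθ1]
  refine ((half_le_measure_good (M := M) hu hu' (by linarith) hN3072).trans
    (measure_mono fun w hw => ?_)).trans (Measure.le_map_apply hmeas.aemeasurable _)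
  exact dim_gt_of_good hρ hm'1 hσ hθ (by positivity) hk0 hk hMmax hM hMk hη0 hη1 hpen hest hsel hw
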